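/- Let $\bar B=\{x\in\mathbb R^n:\|x\|\le1\}$ and let $F:T\bar B=\bar B\times\mathbb R^n\to[0,\infty)$ be a reversible Finsler metric: $F$ is a norm on every $T_x\bar B=\mathbb R^n$, is smooth (up to the boundary of $\bar B$) on $T\bar B\setminus\{0\}$, and for every $x\in\bar B$ and $w\in T_x\bar B\setminus\{0\}$ the bilinear form $$g_w(u,v)=\tfrac12\,\frac{\partial^2}{\partial s\,\partial t}\Big|_{s=t=0}F^2(w+su+tv)\qquad(u,v\in T_x\bar B)$$ is positive definite. Geodesics are the solutions in $\bar B$ of the Euler–Lagrange equation of $\tfrac12F^2$. Suppose that $(\bar B,F)$ is simple, i.e. its boundary $S^{n-1}$ is convex (has non-negative second fundamental form: $\frac{d^2}{dt^2}\big|_{0}\|\gamma\|^2\ge0$ for every geodesic $\gamma$ of a smooth extension of $F$ to a neighbourhood of $\bar B$ which is tangent to $S^{n-1}$ at $\gamma(0)\in S^{n-1}$), there are no conjugate points (a Jacobi field along a non-constant geodesic segment in $\bar B$ that vanishes at both endpoints is zero), and any two distinct points of $\bar B$ are connected by a unique geodesic segment in $\bar B$. Let $\ell(x,y)=\inf_c\int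 F(\dot c)$, where $c$ ranges over the smooth curves in $\bar B$ from $x$ to $y$, and let $\exp_x(v)=\gamma_v(1)$, where $\gamma_v$ is the geodesic with $\dot\gamma_v(0)=v$, defined for those $v\in T_x\bar B$ for which $\gamma_v$ stays in $\bar B$ on $[0,1]$; $\exp_x^{-1}:\bar B\to T_x\bar B$ is its inverse. Let $x,y\in\bar B$, $x\ne y$. Then $\ell(x,y)>0$, the vector $u=\exp_x^{-1}(y)/\ell(x,y)$ satisfies $F(u)=1$, the map $\exp_x^{-1}$ is differentiable at $y$, $\ell(\cdot,y')$ is differentiable at $x$ for all $y'\in\bar B\setminus\{x\}$, with differential denoted $d_1\ell(x,y')$, the map $y'\mapsto d_1\ell(x,y')$ is differentiable at $y$, and the mixed second derivative $D^2_{1,2}\ell(x,y)(v,w):=\frac{d}{dw}\big|_{y}\big(d_1\ell(x,\cdot)v\big)$ satisfies $$D^2_{1,2}\ell(x,y)(v,w)=\frac{-\,g_u\big(P_uv,\;D\exp_x^{-1}(y)\,w\big)}{\ell(x,y)}\qquad\text{for all }v\in T_x\bar B,\ w\in T_y\bar B,$$ where $P_uv=v-g_u(u,v)\,u$ is the projection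 of $T_x\bar B$ onto the $g_u$-orthogonal complement of $u$. At boundary points all derivatives are taken within $\bar B$. -/

import Mathlib

open Set Metric
open scoped ContDiff Topology

noncomputable section

/-- The ambient space `ℝⁿ`; every tangent space of the closed ball is identified with it. -/
abbrev Euc (n : ℕ) : Type := EuclideanSpace ℝ (Fin n)

/-- The closed unit ball of `ℝⁿ`. -/
abbrev cBall (n : ℕ) : Set (Euc n) := closedBall (0 : Euc n) 1

namespace FinslerBall

variable {n : ℕ}

/-- The bilinear form `g_w(u, v) = ½ ∂²/∂s∂t F²(w + s u + t v)` at `s = t = 0`, over the point `x`. -/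
def fundTensor (F : Euc n → Euc n → ℝ) (x w u v : Euc n) : ℝ :=
  deriv (fun s : ℝ => deriv (fun t : ℝ => F x (w + s • u + t • v) ^ 2) 0) 0 / 2

/-- A reversible Finsler metric on the closed unit ball, `F x v` being the norm of `v ∈ T_x`.
Smoothness up to the boundary (away from the zero section) means, as usual, that `F` is the
restriction of a function that is smooth over a neighbourhood of the ball. The values of `F` over
points outside the ball serve only to take derivatives at boundary points; these
derivatives are determined by `F` over the ball. -/
structure IsReversibleFinsler (F : Euc n → Euc n → ℝ) : Prop where
  smooth : ∃ U : Set (Euc n), IsOpen U ∧ cBall n ⊆ U ∧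
    ContDiffOn ℝ ∞ (fun p : Euc n × Euc n => F p.1 p.2) (U ×ˢ {0}ᶜ)
  pos : ∀ x ∈ cBall n, ∀ v : Euc n, v ≠ 0 → 0 < F x v
  homog : ∀ x ∈ cBall n, ∀ (r : ℝ) (v : Euc n), F x (r • v) = |r| * F x v
  triangle : ∀ x ∈ cBall n, ∀ v w : Euc n, F x (v + w) ≤ F x v + F x w
  posDef : ∀ x ∈ cBall n, ∀ w : Euc n, w ≠ 0 → ∀ u : Euc n, u ≠ 0 → 0 < fundTensor F x w u u

/-- The length metric: the infimum of the lengths `∫ F(ċ)` of the smooth curves in the closed ball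
from `x` to `y`. -/
def lengthDist (F : Euc n → Euc n → ℝ) (x y : Euc n) : ℝ :=
  sInf {L : ℝ | ∃ c : ℝ → Euc n, ContDiffOn ℝ ∞ c (Icc 0 1) ∧ MapsTo c (Icc 0 1) (cBall n) ∧
    c 0 = x ∧ c 1 = y ∧ L = ∫ t in (0 : ℝ)..1, F (c t) (derivWithin c (Icc 0 1) t)}

/-- The derivative `∂(½F²)/∂v` of the energy Lagrangian in the vector variable. -/
def vertDeriv (F : Euc n → Euc n → ℝ) (x v : Euc n) : Euc n →L[ℝ] ℝ :=
  fderiv ℝ (fun v' => F x v' ^ 2 / 2) v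

/-- The derivative `∂(½F²)/∂x` of the energy Lagrangian in the base point. -/
def horDeriv (F : Euc n → Euc n → ℝ) (x v : Euc n) : Euc n →L[ℝ] ℝ :=
  fderiv ℝ (fun x' => F x' v ^ 2 / 2) x

/-- `γ : [0,1] → closed ball` is an affinely parametrized geodesic (possibly constant): a solution
of the Euler-Lagrange equation `d/dt ∂L/∂v(γ, γ̇) = ∂L/∂x(γ, γ̇)` of `L = ½F²`. -/
structure IsGeodesic (F : Euc n → Euc n → ℝ) (γ : ℝ → Euc n) : Prop where
  contDiffOn : ContDiffOn ℝ 2 γ (Icc 0 1)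
  mapsTo : MapsTo γ (Icc 0 1) (cBall n)
  eulerLagrange : ∀ t ∈ Icc (0 : ℝ) 1,
    HasDerivWithinAt (fun s => vertDeriv F (γ s) (derivWithin γ (Icc 0 1) s))
      (horDeriv F (γ t) (derivWithin γ (Icc 0 1) t)) (Icc 0 1) t

/-- `J` is a Jacobi field along the geodesic `γ : [0,1] → closed ball`: a solution of the
linearization, along `γ`, of the Euler-Lagrange equation. -/
structure IsJacobiField (F : Euc n → Euc n → ℝ) (γ J : ℝ → Euc n) : Prop where
  contDiffOn : ContDiffOn ℝ 2 J (Icc 0 1)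
  jacobi : ∀ t ∈ Icc (0 : ℝ) 1,
    HasDerivWithinAt
      (fun s => fderiv ℝ (fun p : Euc n × Euc n => vertDeriv F p.1 p.2)
        (γ s, derivWithin γ (Icc 0 1) s) (J s, derivWithin J (Icc 0 1) s))
      (fderiv ℝ (fun p : Euc n × Euc n => horDeriv F p.1 p.2)
        (γ t, derivWithin γ (Icc 0 1) t) (J t, derivWithin J (Icc 0 1) t))
      (Icc 0 1) t

/-- `a` is the second derivative at `t = 0` of the geodesic with initial velocity `v ∈ T_x`: the
curve `x + t v + (t²/2) a` satisfies the Euler-Lagrange equation at `t = 0`. -/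
def IsGeodesicAccel (F : Euc n → Euc n → ℝ) (x v a : Euc n) : Prop :=
  HasDerivAt (fun t : ℝ => vertDeriv F (x + t • v + (t ^ 2 / 2) • a) (v + t • a))
    (horDeriv F x v) 0

/-- Convexity of the boundary sphere (non-negative second fundamental form): along a geodesic `γ`
that is tangent to the sphere at `γ(0) = x`, the second derivative of `½‖γ‖²` at `0` is
non-negative. -/
def ConvexBoundary (F : Euc n → Euc n → ℝ) : Prop :=
  ∀ x v a : Euc n, ‖x‖ = 1 → v ≠ 0 → inner ℝ x v = 0 → IsGeodesicAccel F x v a →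
    0 ≤ ‖v‖ ^ 2 + inner ℝ x a

/-- `F` is a simple reversible Finsler metric on the closed ball: the boundary is convex, there are
no conjugate points, and any two points are connected by a unique geodesic segment. -/
structure IsSimpleFinsler (F : Euc n → Euc n → ℝ) : Prop extends IsReversibleFinsler F where
  convexBoundary : ConvexBoundary F
  noConjugate : ∀ γ : ℝ → Euc n, IsGeodesic F γ → (∀ t ∈ Icc (0 : ℝ) 1, derivWithin γ (Icc 0 1) t ≠ 0) →
    ∀ J : ℝ → Euc n, IsJacobiField F γ J → J 0 = 0 → J 1 = 0 → ∀ t ∈ Icc (0 : ℝ) 1, J t = 0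
  uniqueGeodesic : ∀ x ∈ cBall n, ∀ y ∈ cBall n, x ≠ y →
    ∃ γ : ℝ → Euc n, IsGeodesic F γ ∧ γ 0 = x ∧ γ 1 = y ∧
      ∀ η : ℝ → Euc n, IsGeodesic F η → η 0 = x → η 1 = y → EqOn η γ (Icc 0 1)

/-- The geodesic with initial velocity `v ∈ T_x` stays in the closed ball on `[0,1]` and is at `y`
at time `1`. -/
def ExpRel (F : Euc n → Euc n → ℝ) (x v y : Euc n) : Prop :=
  ∃ γ : ℝ → Euc n, IsGeodesic F γ ∧ γ 0 = x ∧ derivWithin γ (Icc 0 1) 0 = v ∧ γ 1 = y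

/-- The domain of `exp_x`: the vectors whose geodesic stays in the closed ball on `[0,1]`. -/
def expDomain (F : Euc n → Euc n → ℝ) (x : Euc n) : Set (Euc n) :=
  {v | ∃ y, ExpRel F x v y}

open Classical in
/-- The exponential map `exp_x` (with the value `0` outside its domain). -/
def expMap (F : Euc n → Euc n → ℝ) (x v : Euc n) : Euc n :=
  if h : ∃ y, ExpRel F x v y then h.choose else 0

/-- The inverse `exp_x⁻¹` of the exponential map on its domain. -/
def expInv (F : Euc n → Euc n → ℝ) (x : Euc n) : Euc n → Euc n :=
  Function.invFunOn (expMap F x) (expDomain F x)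

/-- The vector `u = exp_x⁻¹(y) / ℓ(x,y)` at `x` pointing towards `y`. -/
def dirVec (F : Euc n → Euc n → ℝ) (x y : Euc n) : Euc n :=
  (lengthDist F x y)⁻¹ • expInv F x y

/-- `P_u v = v - g_u(u,v) u`, over the point `x`. -/
def proj (F : Euc n → Euc n → ℝ) (x u v : Euc n) : Euc n :=
  v - fundTensor F x u u v • u

/-- The partial differential `d₁ℓ(x,y)` of the length metric in its first argument, on the closed
ball (one-sided at boundary points). -/
def d₁ (F : Euc n → Euc n → ℝ) (x y : Euc n) : Euc n →L[ℝ] ℝ :=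
  fderivWithin ℝ (fun x' => lengthDist F x' y) (cBall n) x

/-- The mixed second derivative `D²₁,₂ℓ(x,y)(v,w)`: the derivative of `y ↦ d₁ℓ(x,y) v` in the
direction `w`, on the closed ball. -/
def D₁₂ (F : Euc n → Euc n → ℝ) (x y v w : Euc n) : ℝ :=
  fderivWithin ℝ (fun y' => d₁ F x y') (cBall n) y w v

end FinslerBall

end

/-! Write `e = exp_x⁻¹(y)`. The formula comes from two facts: `ℓ(x,y) = F(e)`, and the first
variation formula `d₁ℓ(x,y) = -∂F/∂v(x,e)`. The right-hand side depends on `y` only through `e`, so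
the mixed derivative at `(v,w)` is minus the fibre Hessian of `F` at `e`, evaluated at `v` and `D
exp_x⁻¹(y) w`. With `r = F(e)` and `u = e/r`, the homogeneity of `F` turns this Hessian into
`(g_u(v,ξ) - g_u(u,v) g_u(u,ξ))/r = g_u(P_u v, ξ)/r`.

The substance is the regularity of `exp_x⁻¹` up to the boundary. Positive definiteness of the fibre
Hessian allows the Euler-Lagrange equation to be solved for the acceleration. The resulting spray
extends to all of `ℝⁿ` and is `C¹` even across the zero section, so after a cutoff it has a global
flow that is differentiable in the initial value (`exists_flow`). Absence of conjugate points makes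
the derivative of the endpoint in the initial velocity invertible (`linearized_injective`). It then
suffices that `exp_x⁻¹` is continuous, since a continuous right inverse of a map with invertible
derivative is differentiable, even relative to the closed ball.

Continuity follows by compactness from uniqueness of geodesics, once their speeds are bounded. For
the bound, convexity of the boundary provides short geodesics between close points of the ball
(`exists_short_geodesic`). A geodesic of great length would, by the pigeonhole principle, return
close to itself after a long arc, against uniqueness (`exists_orbit_bound`).

The Gauss lemma gives the differential of `y ↦ F(exp_x⁻¹(y))`. With the inequality `∂(½F²)/∂v(v) w ≤
F(v) F(w)` it shows that this radius grows along any curve at most at the rate `F(ċ)`, so geodesics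
minimize length (`lengthDist_eq`). Reversibility makes `ℓ` symmetric and transfers the differential
to the first argument. -/

namespace FinslerBall

/-! ### Flows of ordinary differential equations and their dependence on the initial value -/

section ODE

variable {V : Type*} [NormedAddCommGroup V] [NormedSpace ℝ V]

/-- A solution on `[0,1]` of the ordinary differential equation `α' = f(t, α)`. -/
def IsSol (f : ℝ → V → V) (α : ℝ → V) : Prop :=
  ∀ t ∈ Icc (0 : ℝ) 1, HasDerivWithinAt α (f t (α t)) (Icc 0 1) t

theorem IsSol.continuousOn {f : ℝ → V → V} {α : ℝ → V} (h : IsSol f α) :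
    ContinuousOn α (Icc 0 1) := fun t ht => (h t ht).continuousWithinAt

theorem hasDerivWithinAt_Ici_of_Icc {α : ℝ → V} {a : V} {t : ℝ} (ht : t ∈ Ico (0 : ℝ) 1)
    (h : HasDerivWithinAt α a (Icc 0 1) t) : HasDerivWithinAt α a (Ici t) t :=
  h.mono_of_mem_nhdsWithin (Icc_mem_nhdsGE_of_mem ht)

theorem IsSol.dist_le {f : ℝ → V → V} {α β : ℝ → V} {K : NNReal}
    (hf : ∀ t ∈ Icc (0 : ℝ) 1, LipschitzWith K (f t)) (hα : IsSol f α) (hβ : IsSol f β) :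
    ∀ t ∈ Icc (0 : ℝ) 1, dist (α t) (β t) ≤ dist (α 0) (β 0) * Real.exp K := by
  intro t ht
  have h := dist_le_of_trajectories_ODE_of_mem (v := f) (s := fun _ => univ) (K := K)
    (fun t ht => (hf t (Ico_subset_Icc_self ht)).lipschitzOnWith) hα.continuousOn
    (fun t ht => hasDerivWithinAt_Ici_of_Icc ht (hα t (Ico_subset_Icc_self ht)))
    (fun _ _ => trivial) hβ.continuousOn
    (fun t ht => hasDerivWithinAt_Ici_of_Icc ht (hβ t (Ico_subset_Icc_self ht)))
    (fun _ _ => trivial) le_rfl t ht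
  refine h.trans ?_
  gcongr
  have := K.coe_nonneg
  nlinarith [ht.1, ht.2]

/-- Uniqueness of solutions staying in a set on which the field is Lipschitz. -/
theorem IsSol.eqOn {f : ℝ → V → V} {α β : ℝ → V} {K : NNReal} {s : Set V}
    (hf : ∀ t ∈ Icc (0 : ℝ) 1, LipschitzOnWith K (f t) s) (hα : IsSol f α) (hβ : IsSol f β)
    (hαs : MapsTo α (Icc 0 1) s) (hβs : MapsTo β (Icc 0 1) s) (h0 : α 0 = β 0) :
    EqOn α β (Icc 0 1) :=
  ODE_solution_unique_of_mem_Icc_right (v := f) (s := fun _ => s)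
    (fun t ht => hf t (Ico_subset_Icc_self ht)) hα.continuousOn
    (fun t ht => hasDerivWithinAt_Ici_of_Icc ht (hα t (Ico_subset_Icc_self ht)))
    (fun _ h => hαs (Ico_subset_Icc_self h)) hβ.continuousOn
    (fun t ht => hasDerivWithinAt_Ici_of_Icc ht (hβ t (Ico_subset_Icc_self ht)))
    (fun _ h => hβs (Ico_subset_Icc_self h)) h0

variable [CompleteSpace V]

/-- A solution of speed at most `L` moves at most `L` in unit time, so Picard-Lindelöf on the ball
of radius `L` already covers all of `[0,1]`. -/
theorem exists_isSol_of_bounded {f : ℝ → V → V} {K L : NNReal}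
    (hf : ∀ t ∈ Icc (0 : ℝ) 1, LipschitzWith K (f t))
    (hc : ∀ x, ContinuousOn (fun t => f t x) (Icc 0 1))
    (hL : ∀ t ∈ Icc (0 : ℝ) 1, ∀ x, ‖f t x‖ ≤ L) (x₀ : V) :
    ∃ α : ℝ → V, α 0 = x₀ ∧ IsSol f α := by
  have h : IsPicardLindelof f (tmin := 0) (tmax := 1) ⟨0, by simp⟩ x₀ L 0 L K :=
    ⟨fun t ht => (hf t ht).lipschitzOnWith, fun x _ => hc x, fun t ht x _ => hL t ht x, by simp⟩
  obtain ⟨α, h0, hα⟩ := h.exists_eq_forall_mem_Icc_hasDerivWithinAt₀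
  exact ⟨α, h0, hα⟩

variable [FiniteDimensional ℝ V]

/-- A linear field is unbounded, so it is cut off outside the radius that Grönwall's inequality
allows for the solution. The cut-off solution satisfies the same a priori bound, hence never meets
the cutoff. -/
theorem exists_isSol_linear {A : ℝ → V →L[ℝ] V} (hA : ContinuousOn A (Icc 0 1)) (w : V) :
    ∃ Y : ℝ → V, Y 0 = w ∧ IsSol (fun t => A t) Y := by
  obtain ⟨K, hK⟩ := isCompact_Icc.exists_bound_of_continuousOn hA
  have hK0 : 0 ≤ K := (norm_nonneg _).trans (hK 0 (by simp))
  set R : ℝ := ‖w‖ * Real.exp K + 1 with hR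
  have hR0 : 0 < R := by positivity
  let b : ContDiffBump (0 : V) := ⟨R, R + 1, hR0, by linarith⟩
  let ρ : V → V := fun Y => b Y • Y
  have hρc : ContDiff ℝ 1 ρ := b.contDiff.smul contDiff_id
  have hρs : HasCompactSupport ρ := b.hasCompactSupport.smul_right
  obtain ⟨C, hC⟩ := hρc.lipschitzWith_of_hasCompactSupport hρs one_ne_zero
  obtain ⟨L, hL⟩ := hρc.continuous.bounded_above_of_compact_support hρs
  have hL0 : 0 ≤ L := (norm_nonneg _).trans (hL 0)
  obtain ⟨Y, hY0, hY⟩ := exists_isSol_of_bounded (f := fun t Y => A t (ρ Y))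
    (K := ⟨K, hK0⟩ * C) (L := ⟨K * L, by positivity⟩)
    (fun t ht => ((A t).lipschitz.weaken (show ‖A t‖₊ ≤ ⟨K, hK0⟩ from hK t ht)).comp hC)
    (fun x => hA.clm_apply continuousOn_const)
    (fun t ht x => by
      refine ((A t).le_opNorm _).trans ?_
      exact mul_le_mul (hK t ht) (hL x) (norm_nonneg _) hK0) w
  have hbd : ∀ t ∈ Icc (0 : ℝ) 1, ‖Y t‖ ≤ R := by
    intro t ht
    have h := norm_le_gronwallBound_of_norm_deriv_right_le (K := K) (ε := 0) (δ := ‖w‖)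
      hY.continuousOn
      (fun t ht => hasDerivWithinAt_Ici_of_Icc ht (hY t (Ico_subset_Icc_self ht)))
      (by rw [hY0]) (fun t ht => by
        rw [add_zero]
        refine ((A t).le_opNorm _).trans ?_
        refine mul_le_mul (hK t (Ico_subset_Icc_self ht)) ?_ (norm_nonneg _) hK0
        simp only [ρ, norm_smul, Real.norm_eq_abs, abs_of_nonneg b.nonneg]
        exact mul_le_of_le_one_left (norm_nonneg _) b.le_one) t ht
    rw [gronwallBound_ε0] at h
    refine h.trans ?_
    have : Real.exp (K * (t - 0)) ≤ Real.exp K := by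
      gcongr; nlinarith [ht.1, ht.2]
    nlinarith [norm_nonneg w]
  refine ⟨Y, hY0, fun t ht => ?_⟩
  have h1 : ρ (Y t) = Y t := by
    have : b (Y t) = 1 := b.one_of_mem_closedBall (by simpa using hbd t ht)
    simp [ρ, this]
  have := hY t ht
  simp only [h1] at this
  exact this

/-- The linearized flow. -/
theorem exists_linearized_flow {A : ℝ → V →L[ℝ] V} (hA : ContinuousOn A (Icc 0 1)) :
    ∃ D : V →L[ℝ] V, ∀ w, ∃ Y : ℝ → V, Y 0 = w ∧ Y 1 = D w ∧ IsSol (fun t => A t) Y := by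
  choose Y hY0 hY using exists_isSol_linear hA
  obtain ⟨K, hK⟩ := isCompact_Icc.exists_bound_of_continuousOn hA
  have hK0 : 0 ≤ K := (norm_nonneg _).trans (hK 0 (by simp))
  have hu : ∀ {α β : ℝ → V}, IsSol (fun t => A t) α → IsSol (fun t => A t) β → α 0 = β 0 →
      α 1 = β 1 := fun {α β} hα hβ h => IsSol.eqOn (s := univ) (K := ⟨K, hK0⟩)
    (fun t ht => ((A t).lipschitz.weaken (show ‖A t‖₊ ≤ ⟨K, hK0⟩ from hK t ht)).lipschitzOnWith)
    hα hβ (fun _ _ => trivial) (fun _ _ => trivial) h (by simp)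
  let D : V →ₗ[ℝ] V :=
    { toFun := fun w => Y w 1
      map_add' := fun v w => by
        refine hu (β := fun t => Y v t + Y w t) (hY _) (fun t ht => ?_) (by simp [hY0])
        simpa using (hY v t ht).fun_add (hY w t ht)
      map_smul' := fun r w => by
        refine hu (β := fun t => r • Y w t) (hY _) (fun t ht => ?_) (by simp [hY0])
        simpa using (hY w t ht).fun_const_smul r }
  exact ⟨LinearMap.toContinuousLinearMap D, fun w => ⟨Y w, hY0 w, rfl, hY w⟩⟩

/-- A `C¹` field with compact support has a global flow which is differentiable with respect to
the initial value; the derivative is given by the linearized equation. -/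
theorem exists_flow {X : V → V} (hX : ContDiff ℝ 1 X) (hXs : HasCompactSupport X) :
    ∃ Φ : V → ℝ → V, (∀ v, Φ v 0 = v) ∧ (∀ v, IsSol (fun _ => X) (Φ v)) ∧
      (∃ K : NNReal, ∀ v w, ∀ t ∈ Icc (0 : ℝ) 1, dist (Φ v t) (Φ w t) ≤ K * dist v w) ∧
      ∀ v, ∃ D : V →L[ℝ] V, HasFDerivAt (fun w => Φ w 1) D v ∧ ∀ w, ∃ Y : ℝ → V,
        Y 0 = w ∧ Y 1 = D w ∧ IsSol (fun t => fderiv ℝ X (Φ v t)) Y := by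
  obtain ⟨K, hK⟩ := hX.lipschitzWith_of_hasCompactSupport hXs one_ne_zero
  obtain ⟨L, hL⟩ := hX.continuous.bounded_above_of_compact_support hXs
  have hL0 : 0 ≤ L := (norm_nonneg _).trans (hL 0)
  choose Φ hΦ0 hΦ using exists_isSol_of_bounded (f := fun _ => X) (K := K) (L := ⟨L, hL0⟩)
    (fun t _ => hK) (fun x => continuousOn_const) (fun t _ x => hL x)
  have hdist : ∀ v w, ∀ t ∈ Icc (0 : ℝ) 1, dist (Φ v t) (Φ w t) ≤ Real.exp K * dist v w := by
    intro v w t ht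
    have := (hΦ v).dist_le (fun t _ => hK) (hΦ w) t ht
    rwa [hΦ0, hΦ0, mul_comm] at this
  refine ⟨Φ, hΦ0, hΦ, ⟨⟨Real.exp K, by positivity⟩, hdist⟩, fun v => ?_⟩
  have hX' : Continuous (fderiv ℝ X) := hX.continuous_fderiv one_ne_zero
  obtain ⟨D, hD⟩ := exists_linearized_flow (A := fun t => fderiv ℝ X (Φ v t))
    (hX'.comp_continuousOn (hΦ v).continuousOn)
  refine ⟨D, ?_, hD⟩
  have hUC : UniformContinuous (fderiv ℝ X) :=
    (hXs.fderiv ℝ).uniformContinuous_of_continuous hX'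
  rw [hasFDerivAt_iff_isLittleO, Asymptotics.isLittleO_iff]
  intro c hc
  -- the error constant in Grönwall's inequality
  obtain ⟨ε, hε, hεc⟩ : ∃ ε > 0, gronwallBound 0 K (ε * Real.exp K) 1 ≤ c := by
    have h1 : Filter.Tendsto (fun ε => gronwallBound 0 K (ε * Real.exp K) 1) (𝓝[>] 0)
        (𝓝 0) := by
      have h2 : Continuous (fun ε => gronwallBound 0 K (ε * Real.exp K) 1) :=
        (gronwallBound_continuous_ε 0 K 1).comp (continuous_id.mul continuous_const)
      have h3 := h2.tendsto 0
      simp only [zero_mul, gronwallBound_ε0_δ0] at h3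
      exact h3.mono_left nhdsWithin_le_nhds
    obtain ⟨ε, h3, h4⟩ := ((h1.eventually (eventually_le_nhds hc)).and
      self_mem_nhdsWithin).exists
    exact ⟨ε, h4, h3⟩
  obtain ⟨δ, hδ, hδ'⟩ := Metric.uniformContinuous_iff.1 hUC ε hε
  -- Uniform continuity of the derivative makes the first-order Taylor remainder small uniformly in
  -- the base point, hence along the whole trajectory.
  have hrem : ∀ p q : V, dist q p < δ → ‖X q - X p - fderiv ℝ X p (q - p)‖ ≤ ε * ‖q - p‖ := by
    intro p q hq
    refine (convex_ball p δ).norm_image_sub_le_of_norm_hasFDerivWithin_le'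
      (f := X) (f' := fderiv ℝ X) (fun z _ => ((hX.differentiable one_ne_zero) z).hasFDerivAt.hasFDerivWithinAt)
      (fun z hz => ?_) (mem_ball_self hδ) hq
    rw [← dist_eq_norm]
    exact (hδ' hz).le
  have hη : 0 < δ / Real.exp K := by positivity
  filter_upwards [Metric.ball_mem_nhds v hη] with w hw
  obtain ⟨Y, hY0, hY1, hY⟩ := hD (w - v)
  have hclose : ∀ t ∈ Icc (0 : ℝ) 1, dist (Φ w t) (Φ v t) < δ := by
    intro t ht
    refine (hdist w v t ht).trans_lt ?_
    rw [mem_ball, lt_div_iff₀ (Real.exp_pos _)] at hw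
    linarith
  -- The error of the linear approximation starts at `0` and satisfies the linearized equation up to
  -- the Taylor remainder, so Grönwall bounds it by a small multiple of `‖w - v‖`.
  let e : ℝ → V := fun t => Φ w t - Φ v t - Y t
  have he : ∀ t ∈ Icc (0 : ℝ) 1, HasDerivWithinAt e
      (X (Φ w t) - X (Φ v t) - fderiv ℝ X (Φ v t) (Y t)) (Icc 0 1) t := fun t ht =>
    ((hΦ w t ht).sub (hΦ v t ht)).sub (hY t ht)
  have hKd : ∀ p, ‖fderiv ℝ X p‖ ≤ K := fun p => norm_fderiv_le_of_lipschitz ℝ hK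
  have := norm_le_gronwallBound_of_norm_deriv_right_le (f := e) (K := K)
    (ε := ε * Real.exp K * ‖w - v‖) (δ := 0)
    (fun t ht => (he t ht).continuousWithinAt)
    (fun t ht => hasDerivWithinAt_Ici_of_Icc ht (he t (Ico_subset_Icc_self ht)))
    (by simp [e, hΦ0, hY0]) (fun t ht => by
      have ht' := Ico_subset_Icc_self ht
      have h1 := hrem (Φ v t) (Φ w t) (hclose t ht')
      have h2 := hdist w v t ht'
      rw [dist_eq_norm, dist_eq_norm] at h2
      have h3 : X (Φ w t) - X (Φ v t) - fderiv ℝ X (Φ v t) (Y t) =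
          fderiv ℝ X (Φ v t) (e t) +
          (X (Φ w t) - X (Φ v t) - fderiv ℝ X (Φ v t) (Φ w t - Φ v t)) := by
        simp only [e, map_sub]; abel
      rw [h3]
      refine (norm_add_le _ _).trans (add_le_add ?_ ?_)
      · exact ((fderiv ℝ X (Φ v t)).le_opNorm _).trans (by gcongr; exact hKd _)
      · refine h1.trans ?_
        rw [mul_assoc]
        gcongr) 1 (by simp)
  -- With zero initial error the Grönwall bound is linear in the inhomogeneity.
  have hlin : gronwallBound 0 K (ε * Real.exp K * ‖w - v‖) (1 - 0) =
      gronwallBound 0 K (ε * Real.exp K) 1 * ‖w - v‖ := by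
    simp only [gronwallBound]
    split_ifs <;> ring_nf
  rw [hlin] at this
  have he1 : e 1 = Φ w 1 - Φ v 1 - D (w - v) := by simp only [e, hY1]
  rw [he1] at this
  exact this.trans (by gcongr)

end ODE

end FinslerBall

namespace FinslerBall

variable {n : ℕ}

/-! ### The energy Lagrangian and its derivatives -/

/-- The energy Lagrangian `½F²` on the tangent bundle. -/
noncomputable def lag (F : Euc n → Euc n → ℝ) (p : Euc n × Euc n) : ℝ := F p.1 p.2 ^ 2 / 2

/-- The fibre derivative of the energy Lagrangian. -/
noncomputable def vmom (F : Euc n → Euc n → ℝ) (p : Euc n × Euc n) : Euc n →L[ℝ] ℝ :=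
  (fderiv ℝ (lag F) p).comp (ContinuousLinearMap.inr ℝ (Euc n) (Euc n))

/-- The derivative of the energy Lagrangian in the base directions. -/
noncomputable def hmom (F : Euc n → Euc n → ℝ) (p : Euc n × Euc n) : Euc n →L[ℝ] ℝ :=
  (fderiv ℝ (lag F) p).comp (ContinuousLinearMap.inl ℝ (Euc n) (Euc n))

/-- The non-zero tangent vectors over the closed ball. -/
def slit (n : ℕ) : Set (Euc n × Euc n) := cBall n ×ˢ {0}ᶜ

/-- Multiplication by `r` in the fibres of the tangent bundle. -/
noncomputable def fibreScale (r : ℝ) : Euc n × Euc n →L[ℝ] Euc n × Euc n :=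
  (ContinuousLinearMap.fst ℝ (Euc n) (Euc n)).prod (r • ContinuousLinearMap.snd ℝ (Euc n) (Euc n))

@[simp] theorem fibreScale_apply (r : ℝ) (p : Euc n × Euc n) :
    fibreScale r p = (p.1, r • p.2) := rfl

theorem hasDerivAt_fibre_line (z w v : Euc n) :
    HasDerivAt (fun t : ℝ => (z, w + t • v)) ((0 : Euc n), v) 0 := by
  simpa using (hasDerivAt_const (0 : ℝ) z).prodMk
    (((hasDerivAt_id (0 : ℝ)).smul_const v).const_add w)

theorem uniqueDiffOn_cBall : UniqueDiffOn ℝ (cBall n) :=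
  uniqueDiffOn_convex (convex_closedBall _ _)
    ⟨0, by rw [interior_closedBall _ one_ne_zero]; simp⟩

theorem uniqueDiffOn_slit : UniqueDiffOn ℝ (slit n) :=
  uniqueDiffOn_cBall.prod isOpen_compl_singleton.uniqueDiffOn

/-- Functions that agree over the closed ball have the same derivatives over the closed ball,
including the boundary. -/
theorem fderiv_eq_of_eqOn_slit {W : Type*} [NormedAddCommGroup W] [NormedSpace ℝ W]
    {f g : Euc n × Euc n → W} {p : Euc n × Euc n} (hp : p ∈ slit n)
    (hf : DifferentiableAt ℝ f p) (hg : DifferentiableAt ℝ g p) (h : EqOn f g (slit n)) :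
    fderiv ℝ f p = fderiv ℝ g p :=
  (uniqueDiffOn_slit p hp).eq (hf.hasFDerivAt.hasFDerivWithinAt)
    ((hg.hasFDerivAt.hasFDerivWithinAt).congr h (h hp))

/-- An open domain of smoothness permits ordinary derivatives at boundary points. The Finsler axioms
themselves hold only over the ball, so identities are differentiated through
`fderiv_eq_of_eqOn_slit`. -/
theorem IsReversibleFinsler.exists_nhds {F : Euc n → Euc n → ℝ} (hF : IsReversibleFinsler F) :
    ∃ Ω : Set (Euc n × Euc n), IsOpen Ω ∧ slit n ⊆ Ω ∧ ∀ p ∈ Ω, p.2 ≠ 0 ∧ ContDiffAt ℝ ∞ (lag F) p := by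
  obtain ⟨U, hU, hBU, h⟩ := hF.smooth
  refine ⟨U ×ˢ {0}ᶜ, hU.prod isOpen_compl_singleton, prod_mono hBU le_rfl, fun p hp => ⟨hp.2, ?_⟩⟩
  exact ((h.contDiffAt ((hU.prod isOpen_compl_singleton).mem_nhds hp)).pow 2).div_const 2

section

variable {F : Euc n → Euc n → ℝ} {p : Euc n × Euc n}

theorem contDiffAt_fderiv_lag (h : ContDiffAt ℝ ∞ (lag F) p) :
    ContDiffAt ℝ ∞ (fderiv ℝ (lag F)) p := h.fderiv_right (by simp)

theorem contDiffAt_vmom (h : ContDiffAt ℝ ∞ (lag F) p) : ContDiffAt ℝ ∞ (vmom F) p :=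
  (contDiffAt_fderiv_lag h).clm_comp contDiffAt_const

theorem contDiffAt_hmom (h : ContDiffAt ℝ ∞ (lag F) p) : ContDiffAt ℝ ∞ (hmom F) p :=
  (contDiffAt_fderiv_lag h).clm_comp contDiffAt_const

theorem fderiv_lag_apply (w : Euc n × Euc n) :
    fderiv ℝ (lag F) p w = hmom F p w.1 + vmom F p w.2 := by
  simp only [hmom, vmom, ContinuousLinearMap.comp_apply, ContinuousLinearMap.inl_apply,
    ContinuousLinearMap.inr_apply, ← map_add]
  simp

theorem vertDeriv_eq_vmom (h : ContDiffAt ℝ ∞ (lag F) p) : vertDeriv F p.1 p.2 = vmom F p := by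
  have h1 : HasFDerivAt (lag F) (fderiv ℝ (lag F) p) (p.1, p.2) :=
    (h.differentiableAt (by simp)).hasFDerivAt
  exact (HasFDerivAt.comp p.2 (g := lag F) h1 (hasFDerivAt_prodMk_right (𝕜 := ℝ) p.1 p.2)).fderiv

theorem horDeriv_eq_hmom (h : ContDiffAt ℝ ∞ (lag F) p) : horDeriv F p.1 p.2 = hmom F p := by
  have h1 : HasFDerivAt (lag F) (fderiv ℝ (lag F) p) (p.1, p.2) :=
    (h.differentiableAt (by simp)).hasFDerivAt
  exact (HasFDerivAt.comp p.1 (g := lag F) h1 (hasFDerivAt_prodMk_left (𝕜 := ℝ) p.1 p.2)).fderiv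

theorem hasFDerivAt_vmom (h : ContDiffAt ℝ ∞ (lag F) p) :
    HasFDerivAt (vmom F) (fderiv ℝ (vmom F) p) p :=
  ((contDiffAt_vmom h).differentiableAt (by simp)).hasFDerivAt

theorem fderiv_vmom_apply_inr_comm (h : ContDiffAt ℝ ∞ (lag F) p) (u v : Euc n) :
    fderiv ℝ (vmom F) p (0, u) v = fderiv ℝ (vmom F) p (0, v) u := by
  have h1 : HasFDerivAt (fderiv ℝ (lag F)) (fderiv ℝ (fderiv ℝ (lag F)) p) p :=
    ((contDiffAt_fderiv_lag h).differentiableAt (by simp)).hasFDerivAt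
  have h2 : ∀ u v : Euc n, fderiv ℝ (vmom F) p (0, u) v =
      fderiv ℝ (fderiv ℝ (lag F)) p (0, u) (0, v) := by
    intro u v
    have := h1.clm_comp (hasFDerivAt_const (ContinuousLinearMap.inr ℝ (Euc n) (Euc n)) p)
    have h3 : fderiv ℝ (vmom F) p = _ := this.fderiv
    rw [h3]; simp
  rw [h2, h2]
  exact ((contDiffAt_infty.1 h 2).isSymmSndFDerivAt (by simp)).eq _ _

end

/-! ### Consequences of homogeneity and positive definiteness -/

namespace IsReversibleFinsler

variable {F : Euc n → Euc n → ℝ} (hF : IsReversibleFinsler F)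
include hF

theorem contDiffAt_lag {p : Euc n × Euc n} (hp : p ∈ slit n) : ContDiffAt ℝ ∞ (lag F) p := by
  obtain ⟨Ω, -, hs, h⟩ := hF.exists_nhds
  exact (h p (hs hp)).2

theorem eventually_contDiffAt_lag {p : Euc n × Euc n} (hp : p ∈ slit n) :
    ∀ᶠ q in 𝓝 p, ContDiffAt ℝ ∞ (lag F) q := by
  obtain ⟨Ω, ho, hs, h⟩ := hF.exists_nhds
  filter_upwards [ho.mem_nhds (hs hp)] with q hq using (h q hq).2

theorem fderiv_vertDeriv {p : Euc n × Euc n} (hp : p ∈ slit n) :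
    fderiv ℝ (fun q : Euc n × Euc n => vertDeriv F q.1 q.2) p = fderiv ℝ (vmom F) p :=
  Filter.EventuallyEq.fderiv_eq
    ((hF.eventually_contDiffAt_lag hp).mono fun _ h => vertDeriv_eq_vmom h)

theorem fderiv_horDeriv {p : Euc n × Euc n} (hp : p ∈ slit n) :
    fderiv ℝ (fun q : Euc n × Euc n => horDeriv F q.1 q.2) p = fderiv ℝ (hmom F) p :=
  Filter.EventuallyEq.fderiv_eq
    ((hF.eventually_contDiffAt_lag hp).mono fun _ h => horDeriv_eq_hmom h)

theorem apply_zero {z : Euc n} (hz : z ∈ cBall n) : F z 0 = 0 := by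
  simpa using hF.homog z hz 0 0

theorem nonneg {z : Euc n} (hz : z ∈ cBall n) (v : Euc n) : 0 ≤ F z v := by
  rcases eq_or_ne v 0 with rfl | hv
  · rw [hF.apply_zero hz]
  · exact (hF.pos z hz v hv).le

theorem apply_neg {z : Euc n} (hz : z ∈ cBall n) (v : Euc n) : F z (-v) = F z v := by
  simpa using hF.homog z hz (-1) v

theorem lag_smul {z : Euc n} (hz : z ∈ cBall n) (r : ℝ) (v : Euc n) :
    lag F (z, r • v) = r ^ 2 * lag F (z, v) := by
  simp only [lag, hF.homog z hz, mul_pow, sq_abs]; ring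

/-- Euler's identity `∂L/∂v · v = 2L`. -/
theorem vmom_self {p : Euc n × Euc n} (hp : p ∈ slit n) : vmom F p p.2 = 2 * lag F p := by
  have h1 : HasFDerivAt (lag F) (fderiv ℝ (lag F) p) (p.1, (1 : ℝ) • p.2) := by
    rw [one_smul]; exact ((hF.contDiffAt_lag hp).differentiableAt (by simp)).hasFDerivAt
  have h2 : HasDerivAt (fun r : ℝ => (p.1, r • p.2)) ((0 : Euc n), (1 : ℝ) • p.2) 1 :=
    (hasDerivAt_const _ _).prodMk ((hasDerivAt_id (1 : ℝ)).smul_const p.2)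
  have h3 := h1.comp_hasDerivAt (1 : ℝ) h2
  have h4 : HasDerivAt (fun r : ℝ => r ^ 2 * lag F p) (2 * lag F p) 1 := by
    simpa using (hasDerivAt_pow 2 (1 : ℝ)).mul_const (lag F p)
  have h5 : (lag F ∘ fun r : ℝ => (p.1, r • p.2)) = fun r : ℝ => r ^ 2 * lag F p := by
    funext r; exact hF.lag_smul hp.1 r p.2
  rw [h5] at h3
  have := h3.unique h4
  rwa [fderiv_lag_apply, one_smul, map_zero, zero_add] at this

/-- The derivative of Euler's identity. -/
theorem fderiv_vmom_self {p : Euc n × Euc n} (hp : p ∈ slit n) (w : Euc n × Euc n) :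
    fderiv ℝ (vmom F) p w p.2 = 2 * hmom F p w.1 + vmom F p w.2 := by
  have h1 := (hasFDerivAt_vmom (hF.contDiffAt_lag hp)).clm_apply
    (hasFDerivAt_snd (𝕜 := ℝ) (E := Euc n) (F := Euc n) (p := p))
  have h2 : HasFDerivAt (fun q => 2 * lag F q) ((2 : ℝ) • fderiv ℝ (lag F) p) p :=
    ((hF.contDiffAt_lag hp).differentiableAt (by simp)).hasFDerivAt.const_mul 2
  have h3 := fderiv_eq_of_eqOn_slit hp h1.differentiableAt h2.differentiableAt
    (fun q hq => hF.vmom_self hq)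
  rw [h1.fderiv, h2.fderiv] at h3
  have h4 := congrArg (fun l => l w) h3
  simp [fderiv_lag_apply] at h4
  linarith

theorem fderiv_vmom_inr_self {p : Euc n × Euc n} (hp : p ∈ slit n) (u : Euc n) :
    fderiv ℝ (vmom F) p (0, p.2) u = vmom F p u := by
  rw [fderiv_vmom_apply_inr_comm (hF.contDiffAt_lag hp), hF.fderiv_vmom_self hp]; simp

omit hF in
theorem smul_mem_slit {z v : Euc n} (hp : (z, v) ∈ slit n) {r : ℝ} (hr : r ≠ 0) :
    (z, r • v) ∈ slit n := ⟨hp.1, smul_ne_zero hr hp.2⟩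

/-- Differentiated form of the quadratic homogeneity of the Lagrangian. Its vertical and horizontal
parts give the homogeneity of the two momenta, of degrees one and two. -/
theorem fderiv_lag_smul {z v : Euc n} (hp : (z, v) ∈ slit n) {r : ℝ} (hr : r ≠ 0)
    (w : Euc n × Euc n) :
    fderiv ℝ (lag F) (z, r • v) (w.1, r • w.2) = r ^ 2 * fderiv ℝ (lag F) (z, v) w := by
  have h0 := (fibreScale (n := n) r).hasFDerivAt (x := (z, v))
  have h1 : HasFDerivAt (fun q : Euc n × Euc n => lag F (q.1, r • q.2)) _ (z, v) :=
    HasFDerivAt.comp (z, v) (g := lag F)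
      ((hF.contDiffAt_lag (smul_mem_slit hp hr)).differentiableAt (by simp)).hasFDerivAt h0
  have h2 : HasFDerivAt (fun q => r ^ 2 * lag F q) (r ^ 2 • fderiv ℝ (lag F) (z, v)) (z, v) :=
    ((hF.contDiffAt_lag hp).differentiableAt (by simp)).hasFDerivAt.const_mul _
  have h3 := fderiv_eq_of_eqOn_slit hp h1.differentiableAt h2.differentiableAt
    (fun q hq => hF.lag_smul hq.1 r q.2)
  rw [h1.fderiv, h2.fderiv] at h3
  simpa using congrArg (fun l => l w) h3

theorem vmom_smul {z v : Euc n} (hp : (z, v) ∈ slit n) {r : ℝ} (hr : r ≠ 0) :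
    vmom F (z, r • v) = r • vmom F (z, v) := by
  ext u
  have := hF.fderiv_lag_smul hp hr (0, u)
  simp only [fderiv_lag_apply, map_zero, zero_add, map_smul, smul_eq_mul] at this
  have h : r * vmom F (z, r • v) u = r * (r * vmom F (z, v) u) := by rw [this]; ring
  simpa using mul_left_cancel₀ hr h

theorem hmom_smul {z v : Euc n} (hp : (z, v) ∈ slit n) {r : ℝ} (hr : r ≠ 0) :
    hmom F (z, r • v) = r ^ 2 • hmom F (z, v) := by
  ext u
  have := hF.fderiv_lag_smul hp hr (u, 0)
  simpa [fderiv_lag_apply] using this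

theorem fderiv_vmom_smul {z v : Euc n} (hp : (z, v) ∈ slit n) {r : ℝ} (hr : r ≠ 0)
    (w : Euc n × Euc n) :
    fderiv ℝ (vmom F) (z, r • v) (w.1, r • w.2) = r • fderiv ℝ (vmom F) (z, v) w := by
  have h0 := (fibreScale (n := n) r).hasFDerivAt (x := (z, v))
  have h1 : HasFDerivAt (fun q : Euc n × Euc n => vmom F (q.1, r • q.2)) _ (z, v) :=
    HasFDerivAt.comp (z, v) (g := vmom F)
      (hasFDerivAt_vmom (hF.contDiffAt_lag (smul_mem_slit hp hr))) h0
  have h2 : HasFDerivAt (fun q => r • vmom F q) (r • fderiv ℝ (vmom F) (z, v)) (z, v) :=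
    (hasFDerivAt_vmom (hF.contDiffAt_lag hp)).fun_const_smul r
  have h3 := fderiv_eq_of_eqOn_slit hp h1.differentiableAt h2.differentiableAt
    (fun q hq => hF.vmom_smul (z := q.1) (v := q.2) hq hr)
  rw [h1.fderiv, h2.fderiv] at h3
  simpa using congrArg (fun l => l w) h3

theorem hasDerivAt_lag_line {z w : Euc n} (hp : (z, w) ∈ slit n) (v : Euc n) :
    HasDerivAt (fun t : ℝ => lag F (z, w + t • v)) (vmom F (z, w) v) 0 := by
  have h3 : HasFDerivAt (lag F) (fderiv ℝ (lag F) (z, w)) (z, w + (0 : ℝ) • v) := by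
    rw [zero_smul, add_zero]
    exact ((hF.contDiffAt_lag hp).differentiableAt (by simp)).hasFDerivAt
  have h4 := h3.comp_hasDerivAt (0 : ℝ) (hasDerivAt_fibre_line z w v)
  rw [fderiv_lag_apply, map_zero, zero_add] at h4
  exact h4

/-- The fundamental tensor is the fibre Hessian of the energy Lagrangian. -/
theorem fundTensor_eq {z w : Euc n} (hp : (z, w) ∈ slit n) (u v : Euc n) :
    fundTensor F z w u v = fderiv ℝ (vmom F) (z, w) (0, u) v := by
  have h1 : (fun s : ℝ => deriv (fun t : ℝ => F z (w + s • u + t • v) ^ 2) 0) =ᶠ[𝓝 (0 : ℝ)]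
      fun s => 2 * vmom F (z, w + s • u) v := by
    have hc : Continuous fun s : ℝ => w + s • u := by fun_prop
    have : ∀ᶠ s in 𝓝 (0 : ℝ), w + s • u ≠ 0 :=
      hc.continuousAt.eventually_ne (by simpa using hp.2)
    filter_upwards [this] with s hs
    have h4 := (hF.hasDerivAt_lag_line (z := z) (w := w + s • u) ⟨hp.1, hs⟩ v).const_mul 2
    have h5 : (fun t : ℝ => F z (w + s • u + t • v) ^ 2) =
        fun t => 2 * lag F (z, w + s • u + t • v) := by
      funext t; simp only [lag]; ring
    rw [h5, h4.deriv]
  have h3 : HasFDerivAt (vmom F) (fderiv ℝ (vmom F) (z, w)) (z, w + (0 : ℝ) • u) := by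
    rw [zero_smul, add_zero]
    exact hasFDerivAt_vmom (hF.contDiffAt_lag hp)
  have h6 := h3.comp_hasDerivAt (0 : ℝ) (hasDerivAt_fibre_line z w u)
  have h4 : HasDerivAt (fun s : ℝ => 2 * vmom F (z, w + s • u) v)
      (2 * fderiv ℝ (vmom F) (z, w) (0, u) v) 0 := by
    have h7 := ((ContinuousLinearMap.apply ℝ ℝ v).hasFDerivAt.comp_hasDerivAt (0 : ℝ) h6).const_mul 2
    exact h7
  rw [fundTensor, h1.deriv_eq, h4.deriv]; ring

theorem fderiv_vmom_pos {p : Euc n × Euc n} (hp : p ∈ slit n) {u : Euc n} (hu : u ≠ 0) :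
    0 < fderiv ℝ (vmom F) p (0, u) u := by
  rw [← hF.fundTensor_eq (z := p.1) (w := p.2) hp]
  exact hF.posDef p.1 hp.1 p.2 hp.2 u hu

theorem fderiv_vmom_inr_injective {p : Euc n × Euc n} (hp : p ∈ slit n) {u : Euc n}
    (h : fderiv ℝ (vmom F) p (0, u) = 0) : u = 0 := by
  by_contra hu
  have := hF.fderiv_vmom_pos hp hu
  rw [h] at this
  simp at this

/-- The acceleration of a geodesic with a given velocity is unique. -/
theorem spray_unique {p : Euc n × Euc n} (hp : p ∈ slit n) {a b : Euc n}
    (ha : fderiv ℝ (vmom F) p (p.2, a) = hmom F p) (hb : fderiv ℝ (vmom F) p (p.2, b) = hmom F p) :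
    a = b := by
  have : fderiv ℝ (vmom F) p (0, a - b) = 0 := by
    have h : ((0 : Euc n), a - b) = (p.2, a) - (p.2, b) := by simp
    rw [h, map_sub, ha, hb, sub_self]
  exact sub_eq_zero.1 (hF.fderiv_vmom_inr_injective hp this)

theorem spray_smul {z v a : Euc n} (hp : (z, v) ∈ slit n) {r : ℝ} (hr : r ≠ 0)
    (ha : fderiv ℝ (vmom F) (z, v) (v, a) = hmom F (z, v)) :
    fderiv ℝ (vmom F) (z, r • v) (r • v, r ^ 2 • a) = hmom F (z, r • v) := by
  have h1 := hF.fderiv_vmom_smul hp hr (r • v, r • a)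
  have h2 : (r • v, r • a) = r • (v, a) := by simp
  simp only [smul_smul, ← sq] at h1
  rw [h1, h2, map_smul, ha, hF.hmom_smul hp hr, smul_smul, sq]

end IsReversibleFinsler

end FinslerBall

namespace FinslerBall

variable {n : ℕ}

/-! ### The geodesic spray -/

/-- The acceleration of a spray on `ℝⁿ`: positively homogeneous of degree two in the velocity,
smooth away from the zero section, and compactly supported in the base point. -/
structure IsSpray (a : Euc n × Euc n → Euc n) : Prop where
  contDiffAt : ∀ p : Euc n × Euc n, p.2 ≠ 0 → ContDiffAt ℝ ∞ a p
  homog : ∀ (z : Euc n) (r : ℝ) (v : Euc n), 0 < r → a (z, r • v) = r ^ 2 • a (z, v)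
  support : ∃ R : ℝ, ∀ p : Euc n × Euc n, R ≤ ‖p.1‖ → a p = 0

theorem IsReversibleFinsler.isInvertible_fderiv_vmom {F : Euc n → Euc n → ℝ}
    (hF : IsReversibleFinsler F) {p : Euc n × Euc n} (hp : p ∈ slit n) :
    ∃ e : Euc n ≃L[ℝ] (Euc n →L[ℝ] ℝ),
      (e : Euc n →L[ℝ] (Euc n →L[ℝ] ℝ)) =
        (fderiv ℝ (vmom F) p).comp (ContinuousLinearMap.inr ℝ (Euc n) (Euc n)) := by
  set M := (fderiv ℝ (vmom F) p).comp (ContinuousLinearMap.inr ℝ (Euc n) (Euc n)) with hM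
  have hinj : Function.Injective (M : Euc n →ₗ[ℝ] (Euc n →L[ℝ] ℝ)) := by
    rw [injective_iff_map_eq_zero]
    intro u hu
    exact hF.fderiv_vmom_inr_injective hp hu
  have hdim : Module.finrank ℝ (Euc n) = Module.finrank ℝ (Euc n →L[ℝ] ℝ) :=
    (InnerProductSpace.toDual ℝ (Euc n)).toLinearEquiv.finrank_eq
  exact ⟨((M : Euc n →ₗ[ℝ] (Euc n →L[ℝ] ℝ)).linearEquivOfInjective hinj hdim).toContinuousLinearEquiv,
    by ext u : 1; rfl⟩

/-- The chain rule turns the Euler-Lagrange equation into a linear equation for the acceleration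
whose operator is the fibre Hessian. Inverting it gives the spray near the unit vectors over the
ball; homogeneity of degree two extends it to all nonzero vectors, and a cutoff in the base point to
all of `ℝⁿ`. -/
theorem IsReversibleFinsler.exists_spray {F : Euc n → Euc n → ℝ} (hF : IsReversibleFinsler F) :
    ∃ a : Euc n × Euc n → Euc n, IsSpray a ∧
      ∀ p ∈ slit n, fderiv ℝ (vmom F) p (p.2, a p) = hmom F p := by
  obtain ⟨Ω, hΩ, hsΩ, hΩF⟩ := hF.exists_nhds
  let M : Euc n × Euc n → (Euc n →L[ℝ] (Euc n →L[ℝ] ℝ)) := fun p =>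
    (fderiv ℝ (vmom F) p).comp (ContinuousLinearMap.inr ℝ (Euc n) (Euc n))
  have hDV : ∀ p ∈ Ω, ContDiffAt ℝ ∞ (fderiv ℝ (vmom F)) p := fun p hp =>
    (contDiffAt_vmom (hΩF p hp).2).fderiv_right (by simp)
  have hM : ∀ p ∈ Ω, ContDiffAt ℝ ∞ M p := fun p hp => (hDV p hp).clm_comp contDiffAt_const
  -- Invertible operators form an open set, so the acceleration can still be solved for slightly
  -- outside the ball.
  let W : Set (Euc n × Euc n) := Ω ∩ M ⁻¹' (range fun e : Euc n ≃L[ℝ] (Euc n →L[ℝ] ℝ) =>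
    (e : Euc n →L[ℝ] (Euc n →L[ℝ] ℝ)))
  have hW : IsOpen W := ContinuousOn.isOpen_inter_preimage
    (fun p hp => (hM p hp).continuousAt.continuousWithinAt) hΩ ContinuousLinearEquiv.isOpen
  have hsW : slit n ⊆ W := fun p hp => ⟨hsΩ hp, hF.isInvertible_fderiv_vmom hp⟩
  let b : Euc n × Euc n → Euc n := fun p =>
    (M p).inverse (hmom F p - fderiv ℝ (vmom F) p (p.2, 0))
  have hb : ∀ p ∈ W, ContDiffAt ℝ ∞ b p := by
    rintro p ⟨hp, e, he⟩
    have h1 : ContDiffAt ℝ ∞ (fun p => (M p).inverse) p := by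
      have h2 : ContDiffAt ℝ ∞ (ContinuousLinearMap.inverse (R := ℝ)) (M p) := by
        rw [← he]; exact contDiffAt_map_inverse e
      exact h2.comp p (hM p hp)
    exact h1.clm_apply ((contDiffAt_hmom (hΩF p hp).2).sub
      ((hDV p hp).clm_apply (contDiffAt_snd.prodMk contDiffAt_const)))
  have hbs : ∀ p ∈ slit n, fderiv ℝ (vmom F) p (p.2, b p) = hmom F p := by
    intro p hp
    obtain ⟨e, he⟩ := (hsW hp).2
    have h1 : M p (b p) = hmom F p - fderiv ℝ (vmom F) p (p.2, 0) := by
      simp only [b]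
      rw [← he]
      simp
    have h2 : (p.2, b p) = (p.2, (0 : Euc n)) + (0, b p) := by simp
    have h3 : fderiv ℝ (vmom F) p (0, b p) = M p (b p) := rfl
    rw [h2, map_add, h3, h1]; abel
  -- Compactness of the ball and of the unit sphere yields a product neighbourhood, so one
  -- thickening of the ball serves all unit velocities.
  obtain ⟨U, S, hU, -, hBU, hS, hUS⟩ := generalized_tube_lemma (isCompact_closedBall (0 : Euc n) 1)
    (isCompact_sphere (0 : Euc n) 1) hW (fun p hp => hsW ⟨hp.1, fun h => by
      have h1 := hp.2
      rw [mem_singleton_iff.1 h] at h1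
      simp at h1⟩)
  obtain ⟨δ, hδ, hδU⟩ := (isCompact_closedBall (0 : Euc n) 1).exists_cthickening_subset_open hU hBU
  rw [cthickening_closedBall hδ.le zero_le_one] at hδU
  let χ : ContDiffBump (0 : Euc n) := ⟨1, δ + 1, one_pos, by linarith⟩
  have hunit : ∀ v : Euc n, v ≠ 0 → ‖v‖⁻¹ • v ∈ S := fun v hv => hS (by
    rw [mem_sphere_zero_iff_norm, norm_smul, norm_inv, norm_norm,
      inv_mul_cancel₀ (norm_ne_zero_iff.2 hv)])
  refine ⟨fun p => χ p.1 • (‖p.2‖ ^ 2 • b (p.1, ‖p.2‖⁻¹ • p.2)), ⟨?_, ?_, ?_⟩, ?_⟩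
  · intro p hp
    by_cases hpU : p.1 ∈ closedBall (0 : Euc n) (δ + 1)
    · have hn : ContDiffAt ℝ ∞ (fun q : Euc n × Euc n => ‖q.2‖) p :=
        (contDiffAt_norm ℝ hp).comp p contDiffAt_snd
      have h1 : ContDiffAt ℝ ∞ (fun q : Euc n × Euc n => (q.1, ‖q.2‖⁻¹ • q.2)) p :=
        contDiffAt_fst.prodMk ((hn.inv (norm_ne_zero_iff.2 hp)).smul contDiffAt_snd)
      have h2 : ContDiffAt ℝ ∞ (fun q : Euc n × Euc n => b (q.1, ‖q.2‖⁻¹ • q.2)) p :=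
        ContDiffAt.comp p (g := b) (hb _ (hUS ⟨hδU hpU, hunit _ hp⟩)) h1
      exact (χ.contDiff.contDiffAt.comp p contDiffAt_fst).smul ((hn.pow 2).smul h2)
    · have h1 : ∀ᶠ q in 𝓝 p, q.1 ∉ closedBall (0 : Euc n) (δ + 1) :=
        continuousAt_fst.eventually (isClosed_closedBall.isOpen_compl.mem_nhds hpU)
      refine (contDiffAt_const (c := (0 : Euc n))).congr_of_eventuallyEq ?_
      filter_upwards [h1] with q hq
      rw [χ.zero_of_le_dist (by rw [mem_closedBall, not_le] at hq; exact hq.le), zero_smul]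
  · intro z r v hr
    rcases eq_or_ne v 0 with rfl | hv
    · simp
    have h1 : ‖r • v‖⁻¹ • r • v = ‖v‖⁻¹ • v := by
      rw [norm_smul, Real.norm_of_nonneg hr.le, smul_smul]
      congr 1
      field_simp
    simp only [h1]
    rw [norm_smul, Real.norm_of_nonneg hr.le, mul_pow, mul_smul, smul_comm]
  · refine ⟨δ + 1, fun p hp => ?_⟩
    rw [χ.zero_of_le_dist (by simpa using hp), zero_smul]
  · rintro ⟨z, v⟩ hp
    have hv : ‖v‖ ≠ 0 := norm_ne_zero_iff.2 hp.2
    have hz : χ z = 1 := χ.one_of_mem_closedBall hp.1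
    simp only [hz, one_smul]
    have h1 := hF.spray_smul (smul_mem_slit hp (inv_ne_zero hv)) hv
      (hbs _ (smul_mem_slit hp (inv_ne_zero hv)))
    rwa [smul_inv_smul₀ hv] at h1

namespace IsSpray

variable {a : Euc n × Euc n → Euc n} (ha : IsSpray a)
include ha

theorem apply_zero (z : Euc n) : a (z, 0) = 0 := by
  have h := ha.homog z 2 0 two_pos
  rw [smul_zero] at h
  have h2 : (3 : ℝ) • a (z, 0) = 0 := by
    calc (3 : ℝ) • a (z, 0) = (2 : ℝ) ^ 2 • a (z, 0) - a (z, 0) := by module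
      _ = 0 := by rw [← h, sub_self]
  exact (smul_eq_zero.1 h2).resolve_left (by norm_num)

/-- By homogeneity it is enough to bound `a` and its derivative on unit velocities over a compact
base. Base derivatives scale with degree two and fibre derivatives with degree one, whence the two
terms. -/
theorem exists_bound : ∃ C : ℝ, 0 ≤ C ∧ ∀ p : Euc n × Euc n, ‖a p‖ ≤ C * ‖p.2‖ ^ 2 ∧
    (p.2 ≠ 0 → ‖fderiv ℝ a p‖ ≤ C * (‖p.2‖ ^ 2 + ‖p.2‖)) := by
  obtain ⟨R, hR⟩ := ha.support
  have hK : IsCompact (closedBall (0 : Euc n) R ×ˢ sphere (0 : Euc n) 1) :=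
    (isCompact_closedBall _ _).prod (isCompact_sphere _ _)
  have hne : ∀ p ∈ closedBall (0 : Euc n) R ×ˢ sphere (0 : Euc n) 1, p.2 ≠ 0 := by
    intro p hp h
    have h1 := hp.2
    rw [h] at h1
    simp at h1
  obtain ⟨C₁, hC₁⟩ := hK.exists_bound_of_continuousOn (f := a)
    (fun p hp => (ha.contDiffAt p (hne p hp)).continuousAt.continuousWithinAt)
  obtain ⟨C₂, hC₂⟩ := hK.exists_bound_of_continuousOn (f := fderiv ℝ a)
    (fun p hp => ((ha.contDiffAt p (hne p hp)).fderiv_right (m := 0)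
      (by simp)).continuousAt.continuousWithinAt)
  set C := max 0 (max C₁ C₂)
  have hC0 : 0 ≤ C := le_max_left _ _
  have hu : ∀ z v : Euc n, ‖v‖ = 1 → ‖a (z, v)‖ ≤ C ∧ ‖fderiv ℝ a (z, v)‖ ≤ C := by
    intro z v hv
    rcases le_or_gt ‖z‖ R with hz | hz
    · have hm : (z, v) ∈ closedBall (0 : Euc n) R ×ˢ sphere (0 : Euc n) 1 :=
        ⟨by simpa using hz, by simpa using hv⟩
      exact ⟨(hC₁ _ hm).trans (by simp [C]), (hC₂ _ hm).trans (by simp [C])⟩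
    · have h1 : a =ᶠ[𝓝 (z, v)] fun _ => 0 := by
        have : ∀ᶠ q : Euc n × Euc n in 𝓝 (z, v), R < ‖q.1‖ :=
          (continuous_norm.comp continuous_fst).continuousAt.eventually (lt_mem_nhds hz)
        filter_upwards [this] with q hq using hR q hq.le
      rw [h1.fderiv_eq, hR (z, v) hz.le]
      simp [hC0]
  refine ⟨C, hC0, ?_⟩
  rintro ⟨z, v⟩
  rcases eq_or_ne v 0 with rfl | hv
  · simp [ha.apply_zero]
  have hv' : ‖v‖ ≠ 0 := norm_ne_zero_iff.2 hv
  have hv0 : 0 < ‖v‖ := norm_pos_iff.2 hv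
  have hn : ‖‖v‖⁻¹ • v‖ = 1 := by
    rw [norm_smul, norm_inv, norm_norm, inv_mul_cancel₀ hv']
  obtain ⟨h1, h2⟩ := hu z (‖v‖⁻¹ • v) hn
  have hfun : a = fun q => ‖v‖ ^ 2 • (a ∘ fibreScale ‖v‖⁻¹) q := by
    funext q
    rw [Function.comp_apply, fibreScale_apply, ha.homog _ _ _ (inv_pos.2 hv0), smul_smul,
      inv_pow, mul_inv_cancel₀ (pow_ne_zero 2 hv'), one_smul]
  constructor
  · have := congrFun hfun (z, v)
    rw [this]
    simp only [Function.comp_apply, fibreScale_apply, norm_smul, norm_pow, norm_norm]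
    rw [mul_comm]
    gcongr
  · intro _
    have hd : HasFDerivAt (a ∘ fibreScale ‖v‖⁻¹)
        ((fderiv ℝ a (z, ‖v‖⁻¹ • v)).comp (fibreScale ‖v‖⁻¹)) (z, v) :=
      HasFDerivAt.comp (z, v) (g := a) (((ha.contDiffAt (z, ‖v‖⁻¹ • v) (smul_ne_zero
        (inv_ne_zero hv') hv)).differentiableAt (by simp)).hasFDerivAt)
        (fibreScale ‖v‖⁻¹).hasFDerivAt
    have hd2 := (hd.fun_const_smul (‖v‖ ^ 2)).fderiv
    rw [← hfun] at hd2
    rw [hd2, norm_smul, norm_pow, norm_norm]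
    have hs : ‖fibreScale (n := n) ‖v‖⁻¹‖ ≤ 1 + ‖v‖⁻¹ := by
      refine ContinuousLinearMap.opNorm_le_bound _ (by positivity) fun q => ?_
      rw [fibreScale_apply, Prod.norm_def, norm_smul, norm_inv, norm_norm]
      have e1 := norm_fst_le q
      have e2 := norm_snd_le q
      have e3 : 0 ≤ ‖v‖⁻¹ := by positivity
      refine max_le ?_ ?_
      · nlinarith [norm_nonneg q]
      · nlinarith [norm_nonneg q]
    calc ‖v‖ ^ 2 * ‖(fderiv ℝ a (z, ‖v‖⁻¹ • v)).comp (fibreScale ‖v‖⁻¹)‖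
        ≤ ‖v‖ ^ 2 * (C * (1 + ‖v‖⁻¹)) := by
          gcongr
          exact (ContinuousLinearMap.opNorm_comp_le _ _).trans (by gcongr)
      _ = C * (‖v‖ ^ 2 + ‖v‖) := by field_simp

theorem hasFDerivAt_zero (z : Euc n) : HasFDerivAt a (0 : Euc n × Euc n →L[ℝ] Euc n) (z, 0) := by
  obtain ⟨C, hC0, hC⟩ := ha.exists_bound
  rw [hasFDerivAt_iff_isLittleO]
  simp only [ha.apply_zero, sub_zero, zero_apply]
  refine Asymptotics.IsBigO.trans_isLittleO (g := fun q : Euc n × Euc n => ‖q - (z, 0)‖ ^ 2) ?_ ?_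
  · refine Asymptotics.IsBigO.of_bound C (Filter.Eventually.of_forall fun q => ?_)
    refine (hC q).1.trans ?_
    rw [norm_pow, norm_norm]
    gcongr
    have h := norm_snd_le (q - (z, 0))
    rwa [Prod.snd_sub, sub_zero] at h
  · rw [Asymptotics.isLittleO_iff]
    intro c hc
    filter_upwards [ball_mem_nhds (z, (0 : Euc n)) hc] with q hq
    rw [norm_pow, norm_norm, sq]
    rw [mem_ball, dist_eq_norm] at hq
    gcongr

theorem exists_fderiv_bound : ∃ C : ℝ, 0 ≤ C ∧ ∀ p : Euc n × Euc n,
    ‖fderiv ℝ a p‖ ≤ C * (‖p.2‖ ^ 2 + ‖p.2‖) := by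
  obtain ⟨C, hC0, hC⟩ := ha.exists_bound
  refine ⟨C, hC0, fun p => ?_⟩
  rcases eq_or_ne p.2 0 with h | h
  · have : p = (p.1, 0) := by rw [← h]
    rw [this, (ha.hasFDerivAt_zero p.1).fderiv]
    simp
  · exact (hC p).2 h

/-- Degree two makes `a` and its derivative vanish continuously at the zero section. Higher
derivatives need not extend there, but `C¹` is all that the flow requires. -/
theorem contDiff_one : ContDiff ℝ 1 a := by
  rw [contDiff_one_iff_fderiv]
  constructor
  · intro p
    rcases eq_or_ne p.2 0 with h | h
    · have : p = (p.1, 0) := by rw [← h]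
      rw [this]
      exact (ha.hasFDerivAt_zero p.1).differentiableAt
    · exact (ha.contDiffAt p h).differentiableAt (by simp)
  · rw [continuous_iff_continuousAt]
    intro p
    rcases eq_or_ne p.2 0 with h | h
    · obtain ⟨C, hC0, hC⟩ := ha.exists_fderiv_bound
      have : p = (p.1, 0) := by rw [← h]
      rw [this, ContinuousAt, (ha.hasFDerivAt_zero p.1).fderiv]
      refine squeeze_zero_norm hC ?_
      have : Continuous fun q : Euc n × Euc n => C * (‖q.2‖ ^ 2 + ‖q.2‖) := by fun_prop
      simpa using this.tendsto (p.1, 0)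
    · exact ((ha.contDiffAt p h).fderiv_right (m := 0) (by simp)).continuousAt

end IsSpray

end FinslerBall

namespace FinslerBall

variable {n : ℕ}

/-! ### Norm estimates -/

namespace IsReversibleFinsler

variable {F : Euc n → Euc n → ℝ} (hF : IsReversibleFinsler F)
include hF

theorem continuousOn_slit : ContinuousOn (fun p : Euc n × Euc n => F p.1 p.2) (slit n) := by
  obtain ⟨U, hU, hBU, h⟩ := hF.smooth
  exact h.continuousOn.mono (prod_mono hBU le_rfl)

theorem exists_norm_bounds : ∃ m M : ℝ, 0 < m ∧ 0 ≤ M ∧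
    ∀ z ∈ cBall n, ∀ v, m * ‖v‖ ≤ F z v ∧ F z v ≤ M * ‖v‖ := by
  have hK : IsCompact (cBall n ×ˢ sphere (0 : Euc n) 1) :=
    (isCompact_closedBall _ _).prod (isCompact_sphere _ _)
  have hKs : cBall n ×ˢ sphere (0 : Euc n) 1 ⊆ slit n := fun p hp => ⟨hp.1, fun h => by
    have h1 := hp.2
    rw [mem_singleton_iff.1 h] at h1
    simp at h1⟩
  have hc := hF.continuousOn_slit.mono hKs
  obtain ⟨m, hm, hm'⟩ := hK.exists_forall_le' hc (a := 0)
    (fun p hp => hF.pos p.1 hp.1 p.2 (hKs hp).2)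
  obtain ⟨M, hM⟩ := hK.exists_bound_of_continuousOn hc
  refine ⟨m, max 0 M, hm, le_max_left _ _, fun z hz v => ?_⟩
  rcases eq_or_ne v 0 with rfl | hv
  · simp [hF.apply_zero hz]
  have hv' : ‖v‖ ≠ 0 := norm_ne_zero_iff.2 hv
  have hu : (z, ‖v‖⁻¹ • v) ∈ cBall n ×ˢ sphere (0 : Euc n) 1 := ⟨hz, by
    rw [mem_sphere_zero_iff_norm, norm_smul, norm_inv, norm_norm, inv_mul_cancel₀ hv']⟩
  have h1 : F z v = ‖v‖ * F z (‖v‖⁻¹ • v) := by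
    have := hF.homog z hz ‖v‖ (‖v‖⁻¹ • v)
    rwa [smul_inv_smul₀ hv', abs_norm] at this
  have h2 := hm' _ hu
  have h3 := (le_abs_self _).trans ((hM _ hu).trans (le_max_right 0 M))
  simp only at h2 h3
  rw [h1]
  constructor <;> nlinarith [norm_nonneg v]

theorem continuousOn : ContinuousOn (fun p : Euc n × Euc n => F p.1 p.2) (cBall n ×ˢ univ) := by
  rintro ⟨z, v⟩ hp
  rcases eq_or_ne v 0 with rfl | hv
  · obtain ⟨m, M, hm, hM, h⟩ := hF.exists_norm_bounds
    rw [ContinuousWithinAt, hF.apply_zero hp.1]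
    refine squeeze_zero_norm' (a := fun q : Euc n × Euc n => M * ‖q.2‖) ?_ ?_
    · filter_upwards [self_mem_nhdsWithin] with q hq
      rw [Real.norm_of_nonneg (hF.nonneg hq.1 _)]
      exact (h q.1 hq.1 q.2).2
    · have : Continuous fun q : Euc n × Euc n => M * ‖q.2‖ := by fun_prop
      simpa using (this.tendsto (z, 0)).mono_left nhdsWithin_le_nhds
  · have h1 := hF.continuousOn_slit (z, v) ⟨hp.1, hv⟩
    refine h1.mono_of_mem_nhdsWithin ?_
    have h2 : ∀ᶠ q : Euc n × Euc n in 𝓝 (z, v), q.2 ≠ 0 := continuousAt_snd.eventually_ne hv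
    filter_upwards [self_mem_nhdsWithin, nhdsWithin_le_nhds h2] with q hq hq2 using ⟨hq.1, hq2⟩

/-- The fundamental inequality of Finsler geometry. -/
theorem vmom_le {p : Euc n × Euc n} (hp : p ∈ slit n) (w : Euc n) :
    vmom F p w ≤ F p.1 p.2 * F p.1 w := by
  have h1 := hF.hasDerivAt_lag_line (z := p.1) (w := p.2) hp w
  have h2 : HasDerivAt (fun t : ℝ => (F p.1 p.2 + t * F p.1 w) ^ 2 / 2)
      (F p.1 p.2 * F p.1 w) 0 := by
    have := ((((hasDerivAt_id (0 : ℝ)).mul_const (F p.1 w)).const_add (F p.1 p.2)).fun_pow 2).div_const 2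
    exact this.congr_deriv (by simp; ring)
  have h3 := (h2.sub h1).hasDerivWithinAt (s := Ioi 0)
  rw [hasDerivWithinAt_iff_tendsto_slope' (by simp)] at h3
  refine sub_nonneg.1 (ge_of_tendsto h3 ?_)
  filter_upwards [self_mem_nhdsWithin] with t ht
  have ht' : 0 < t := ht
  rw [slope_def_field]
  refine div_nonneg ?_ (by linarith)
  simp only [Pi.sub_apply, zero_mul, add_zero, zero_smul, lag]
  have h4 := hF.triangle p.1 hp.1 p.2 (t • w)
  rw [hF.homog p.1 hp.1, abs_of_pos ht'] at h4
  have h5 := hF.nonneg hp.1 (p.2 + t • w)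
  have h6 : F p.1 (p.2 + t • w) ^ 2 ≤ (F p.1 p.2 + t * F p.1 w) ^ 2 := by gcongr
  linarith

theorem lag_le {M : ℝ} (hM : ∀ z ∈ cBall n, ∀ v, F z v ≤ M * ‖v‖) {z : Euc n} (hz : z ∈ cBall n)
    (v : Euc n) : ‖lag F (z, v)‖ ≤ M ^ 2 / 2 * ‖v‖ ^ 2 := by
  rw [Real.norm_of_nonneg (by unfold lag; positivity)]
  have h1 := hM z hz v
  have h2 := hF.nonneg hz v
  have : F z v ^ 2 ≤ (M * ‖v‖) ^ 2 := by gcongr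
  simp only [lag]
  nlinarith

theorem vertDeriv_zero {z : Euc n} (hz : z ∈ cBall n) : vertDeriv F z 0 = 0 := by
  obtain ⟨m, M, hm, hM, h⟩ := hF.exists_norm_bounds
  refine HasFDerivAt.fderiv ?_
  rw [hasFDerivAt_iff_isLittleO]
  simp only [hF.apply_zero hz, sub_zero, zero_apply, ne_eq, OfNat.ofNat_ne_zero,
    not_false_eq_true, zero_pow, zero_div]
  refine Asymptotics.IsBigO.trans_isLittleO (g := fun v : Euc n => ‖v‖ ^ 2) ?_ ?_
  · refine Asymptotics.IsBigO.of_bound (M ^ 2 / 2) (Filter.Eventually.of_forall fun v => ?_)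
    rw [norm_pow, norm_norm]
    exact hF.lag_le (fun z hz v => (h z hz v).2) hz v
  · exact Asymptotics.isLittleO_norm_pow_id one_lt_two

theorem vertDeriv_eq {p : Euc n × Euc n} (hp : p ∈ slit n) : vertDeriv F p.1 p.2 = vmom F p :=
  vertDeriv_eq_vmom (hF.contDiffAt_lag hp)

/-- Comparability of momentum and velocity replaces the chain rule on the zero section, where the
Lagrangian is not assumed smooth. -/
theorem exists_vertDeriv_bounds : ∃ m M : ℝ, 0 < m ∧ 0 ≤ M ∧
    ∀ z ∈ cBall n, ∀ v, m * ‖v‖ ≤ ‖vertDeriv F z v‖ ∧ ‖vertDeriv F z v‖ ≤ M * ‖v‖ := by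
  obtain ⟨m, M, hm, hM, h⟩ := hF.exists_norm_bounds
  refine ⟨m ^ 2, M ^ 2, by positivity, by positivity, fun z hz v => ?_⟩
  rcases eq_or_ne v 0 with rfl | hv
  · simp [hF.vertDeriv_zero hz]
  have hp : (z, v) ∈ slit n := ⟨hz, hv⟩
  rw [hF.vertDeriv_eq hp]
  have hv' : 0 < ‖v‖ := norm_pos_iff.2 hv
  constructor
  · have h1 := hF.vmom_self hp
    have h2 := (le_abs_self _).trans ((vmom F (z, v)).le_opNorm v)
    simp only [lag] at h1
    rw [h1] at h2
    have h3 := (h z hz v).1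
    have h4 : (m * ‖v‖) ^ 2 ≤ F z v ^ 2 := by gcongr
    refine le_of_mul_le_mul_right ?_ hv'
    calc m ^ 2 * ‖v‖ * ‖v‖ = (m * ‖v‖) ^ 2 := by ring
      _ ≤ _ := by linarith
  · have h5 : ∀ w, vmom F (z, v) w ≤ M ^ 2 * ‖v‖ * ‖w‖ := by
      intro w
      refine (hF.vmom_le hp w).trans ?_
      have h6 := mul_le_mul (h z hz v).2 (h z hz w).2 (hF.nonneg hz w) (by positivity)
      refine h6.trans (le_of_eq (by ring))
    refine ContinuousLinearMap.opNorm_le_bound _ (by positivity) fun w => ?_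
    rw [Real.norm_eq_abs, abs_le]
    have h6 := h5 (-w)
    rw [map_neg, norm_neg] at h6
    exact ⟨by linarith, h5 w⟩

theorem horDeriv_zero {z : Euc n} (hz : z ∈ cBall n) : horDeriv F z 0 = 0 := by
  -- Outside the ball the values `F x' 0` are unrestricted, so differentiability at a boundary point
  -- may fail; `fderiv` is then `0` by default.
  by_cases h : DifferentiableAt ℝ (fun x' => F x' 0 ^ 2 / 2) z
  · refine (uniqueDiffOn_cBall z hz).eq h.hasFDerivAt.hasFDerivWithinAt ?_
    refine (hasFDerivWithinAt_const (0 : ℝ) z _).congr (fun x hx => ?_) ?_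
    · simp [hF.apply_zero hx]
    · simp [hF.apply_zero hz]
  · exact fderiv_zero_of_not_differentiableAt h

end IsReversibleFinsler

/-! ### Geodesics as orbits of the spray -/

/-- `a` is the geodesic spray of `F` over the closed ball. -/
structure IsGeodesicSpray (F : Euc n → Euc n → ℝ) (a : Euc n × Euc n → Euc n) : Prop
    extends IsSpray a where
  eulerLagrange : ∀ p ∈ slit n, fderiv ℝ (vmom F) p (p.2, a p) = hmom F p

/-- The first order vector field of a spray. -/
def sprayField (a : Euc n × Euc n → Euc n) (p : Euc n × Euc n) : Euc n × Euc n := (p.2, a p)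

/-- `c` is an orbit of the spray over the closed ball. -/
structure IsOrbit (a : Euc n × Euc n → Euc n) (c : ℝ → Euc n × Euc n) : Prop where
  isSol : IsSol (fun _ => sprayField a) c
  mapsTo : MapsTo (fun t => (c t).1) (Icc 0 1) (cBall n)

theorem HasDerivWithinAt.fst_pair {c : ℝ → Euc n × Euc n} {w : Euc n × Euc n} {s : Set ℝ} {t : ℝ}
    (h : HasDerivWithinAt c w s t) : HasDerivWithinAt (fun t => (c t).1) w.1 s t := by
  exact (hasFDerivAt_fst (𝕜 := ℝ) (p := c t)).comp_hasDerivWithinAt t h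

theorem HasDerivWithinAt.snd_pair {c : ℝ → Euc n × Euc n} {w : Euc n × Euc n} {s : Set ℝ} {t : ℝ}
    (h : HasDerivWithinAt c w s t) : HasDerivWithinAt (fun t => (c t).2) w.2 s t := by
  exact (hasFDerivAt_snd (𝕜 := ℝ) (p := c t)).comp_hasDerivWithinAt t h

theorem uniqueDiff_Icc : UniqueDiffOn ℝ (Icc (0 : ℝ) 1) := uniqueDiffOn_Icc one_pos

theorem IsSpray.contDiff_sprayField {a : Euc n × Euc n → Euc n} (ha : IsSpray a) :
    ContDiff ℝ 1 (sprayField a) := contDiff_snd.prodMk ha.contDiff_one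

/-- The spray field cut off to a compactly supported one. -/
theorem IsSpray.exists_cutoff {a : Euc n × Euc n → Euc n} (ha : IsSpray a) {R : ℝ} (hR : 0 < R) :
    ∃ X : Euc n × Euc n → Euc n × Euc n, ContDiff ℝ 1 X ∧ HasCompactSupport X ∧
      ∀ p, ‖p‖ ≤ R → X p = sprayField a p ∧ fderiv ℝ X p = fderiv ℝ (sprayField a) p := by
  let b : ContDiffBump (0 : Euc n × Euc n) := ⟨R + 1, R + 2, by linarith, by linarith⟩
  refine ⟨fun p => b p • sprayField a p, b.contDiff.smul ha.contDiff_sprayField,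
    b.hasCompactSupport.smul_right, fun p hp => ?_⟩
  have h : (fun p => b p • sprayField a p) =ᶠ[𝓝 p] sprayField a := by
    have : ∀ᶠ q in 𝓝 p, ‖q‖ < R + 1 :=
      continuous_norm.continuousAt.eventually (gt_mem_nhds (by linarith))
    filter_upwards [this] with q hq
    rw [b.one_of_mem_closedBall (by simpa using hq.le), one_smul]
  exact ⟨h.eq_of_nhds, h.fderiv_eq⟩

/-- The spray field is only locally Lipschitz, but two given solutions stay in a common ball, on
which it agrees with a compactly supported `C¹` field. -/
theorem IsSpray.isSol_unique {a : Euc n × Euc n → Euc n} (ha : IsSpray a)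
    {c d : ℝ → Euc n × Euc n} (hc : IsSol (fun _ => sprayField a) c)
    (hd : IsSol (fun _ => sprayField a) d) (h : c 0 = d 0) : EqOn c d (Icc 0 1) := by
  obtain ⟨R₁, h₁⟩ := isCompact_Icc.exists_bound_of_continuousOn hc.continuousOn
  obtain ⟨R₂, h₂⟩ := isCompact_Icc.exists_bound_of_continuousOn hd.continuousOn
  set R := max 1 (max R₁ R₂)
  obtain ⟨X, hX, hXs, hXe⟩ := ha.exists_cutoff (R := R) (by positivity)
  obtain ⟨K, hK⟩ := hX.lipschitzWith_of_hasCompactSupport hXs one_ne_zero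
  refine IsSol.eqOn (K := K) (s := closedBall 0 R) (fun t _ => ?_) hc hd ?_ ?_ h
  · intro p hp q hq
    rw [← (hXe p (by simpa using hp)).1, ← (hXe q (by simpa using hq)).1]
    exact hK p q
  · intro t ht; simpa [R] using .inr (.inl (h₁ t ht))
  · intro t ht; simpa [R] using .inr (.inr (h₂ t ht))

theorem isLittleO_of_deriv_zero {W : Type*} [NormedAddCommGroup W] [NormedSpace ℝ W] {f : ℝ → W}
    {s : Set ℝ} {t : ℝ} (h : HasDerivWithinAt f 0 s t) (h0 : f t = 0) :
    f =o[𝓝[s] t] fun x => x - t := by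
  have := hasDerivWithinAt_iff_isLittleO.1 h
  simpa [h0] using this

theorem hasDerivWithinAt_zero_of_le {V W : Type*} [NormedAddCommGroup W] [NormedSpace ℝ W]
    [NormedAddCommGroup V] [NormedSpace ℝ V] {f : ℝ → V} {g : ℝ → W} {s : Set ℝ} {t C : ℝ}
    (ht : t ∈ s) (h : HasDerivWithinAt f 0 s t) (h0 : f t = 0) (hg : ∀ x ∈ s, ‖g x‖ ≤ C * ‖f x‖) :
    HasDerivWithinAt g 0 s t := by
  have hg0 : g t = 0 := by
    have := hg t ht
    rw [h0, norm_zero, mul_zero] at this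
    exact norm_le_zero_iff.1 this
  rw [hasDerivWithinAt_iff_isLittleO]
  simp only [hg0, sub_zero, smul_zero]
  refine Asymptotics.IsBigO.trans_isLittleO ?_ (isLittleO_of_deriv_zero h h0)
  refine Asymptotics.IsBigO.of_bound C ?_
  filter_upwards [self_mem_nhdsWithin] with x hx using hg x hx

section

variable {F : Euc n → Euc n → ℝ} (hF : IsReversibleFinsler F) {a : Euc n × Euc n → Euc n}
  (ha : IsGeodesicSpray F a)
include hF ha

/-- At nonzero velocity the Euler-Lagrange equation determines the acceleration, because the fibre
Hessian is injective. Where the velocity vanishes, so do the momentum and its derivative; the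
velocity is bounded by a multiple of the momentum, so its derivative vanishes too. -/
theorem IsGeodesic.isOrbit {γ : ℝ → Euc n} (hγ : IsGeodesic F γ) :
    IsOrbit a fun t => (γ t, derivWithin γ (Icc 0 1) t) := by
  set σ := derivWithin γ (Icc 0 1) with hσ
  have hσ1 : ContDiffOn ℝ 1 σ (Icc 0 1) := hγ.contDiffOn.derivWithin uniqueDiff_Icc (by norm_num)
  refine ⟨fun t ht => ?_, hγ.mapsTo⟩
  have h1 : HasDerivWithinAt γ (σ t) (Icc 0 1) t :=
    ((hγ.contDiffOn.differentiableOn two_ne_zero) t ht).hasDerivWithinAt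
  have h2 : HasDerivWithinAt σ (derivWithin σ (Icc 0 1) t) (Icc 0 1) t :=
    ((hσ1.differentiableOn one_ne_zero) t ht).hasDerivWithinAt
  have h3 := hγ.eulerLagrange t ht
  rw [← hσ] at h3
  refine h1.prodMk ?_
  by_cases h0 : σ t = 0
  · rw [h0, ha.apply_zero]
    rw [h0, hF.horDeriv_zero (hγ.mapsTo ht)] at h3
    obtain ⟨m, M, hm, hM, hb⟩ := hF.exists_vertDeriv_bounds
    refine hasDerivWithinAt_zero_of_le (C := m⁻¹) ht h3
      (by simp only [h0]; exact hF.vertDeriv_zero (hγ.mapsTo ht)) (fun x hx => ?_)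
    rw [← div_eq_inv_mul, le_div_iff₀ hm, mul_comm]
    exact (hb _ (hγ.mapsTo hx) _).1
  · have hp : (γ t, σ t) ∈ slit n := ⟨hγ.mapsTo ht, h0⟩
    have h4 := (hasFDerivAt_vmom (hF.contDiffAt_lag hp)).comp_hasDerivWithinAt t (h1.prodMk h2)
    have h5 : (vmom F ∘ fun s => (γ s, σ s)) =ᶠ[𝓝[Icc 0 1] t]
        fun s => vertDeriv F (γ s) (σ s) := by
      have := (h1.prodMk h2).continuousWithinAt.eventually (hF.eventually_contDiffAt_lag hp)
      filter_upwards [this] with s hs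
      exact (vertDeriv_eq_vmom hs).symm
    have h6 := h4.congr_of_eventuallyEq_of_mem h5.symm ht
    have h7 := (uniqueDiff_Icc t ht).eq_deriv _ h6 h3
    rw [horDeriv_eq_hmom (p := (γ t, σ t)) (hF.contDiffAt_lag hp)] at h7
    rw [hF.spray_unique hp (ha.eulerLagrange _ hp) h7]
    exact h2

omit hF ha in
theorem IsOrbit.derivWithin_eq {c : ℝ → Euc n × Euc n} (hc : IsOrbit a c) {t : ℝ}
    (ht : t ∈ Icc (0 : ℝ) 1) : derivWithin (fun t => (c t).1) (Icc 0 1) t = (c t).2 :=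
  (HasDerivWithinAt.fst_pair (hc.isSol t ht)).derivWithin (uniqueDiff_Icc t ht)

theorem IsOrbit.isGeodesic {c : ℝ → Euc n × Euc n} (hc : IsOrbit a c) :
    IsGeodesic F fun t => (c t).1 := by
  have hd : EqOn (derivWithin (fun t => (c t).1) (Icc 0 1)) (fun t => (c t).2) (Icc 0 1) :=
    fun t ht => hc.derivWithin_eq ht
  have h1 : ContDiffOn ℝ 1 c (Icc 0 1) := by
    refine ODE.contDiffOn_enat_Icc_of_hasDerivWithinAt (n := 1) (f := fun _ => sprayField a)
      (u := univ) ?_ hc.isSol (mapsTo_univ _ _)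
    exact (ha.contDiff_sprayField.comp contDiff_snd).contDiffOn
  refine ⟨?_, hc.mapsTo, fun t ht => ?_⟩
  · rw [show (2 : WithTop ℕ∞) = 1 + 1 by norm_num, contDiffOn_succ_iff_derivWithin uniqueDiff_Icc]
    refine ⟨fun t ht => (HasDerivWithinAt.fst_pair (hc.isSol t ht)).differentiableWithinAt,
      by simp, ?_⟩
    exact (contDiff_snd.comp_contDiffOn h1).congr hd
  · have hfun : ∀ s ∈ Icc (0 : ℝ) 1, vertDeriv F (c s).1 (derivWithin (fun t => (c t).1) (Icc 0 1) s)
        = vertDeriv F (c s).1 (c s).2 := fun s hs => by rw [hd hs]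
    refine HasDerivWithinAt.congr ?_ hfun (hfun t ht)
    rw [hd ht]
    by_cases h0 : (c t).2 = 0
    · simp only [h0]
      rw [hF.horDeriv_zero (hc.mapsTo ht)]
      obtain ⟨m, M, hm, hM, hb⟩ := hF.exists_vertDeriv_bounds
      have h2 := HasDerivWithinAt.snd_pair (hc.isSol t ht)
      have h3 : c t = ((c t).1, 0) := by rw [← h0]
      simp only [sprayField] at h2
      rw [h3, ha.apply_zero] at h2
      exact hasDerivWithinAt_zero_of_le ht h2 h0 fun x hx => (hb _ (hc.mapsTo hx) _).2
    · have hp : c t ∈ slit n := ⟨hc.mapsTo ht, h0⟩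
      have h4 := (hasFDerivAt_vmom (hF.contDiffAt_lag hp)).comp_hasDerivWithinAt t (hc.isSol t ht)
      have h5 : (fun s => vertDeriv F (c s).1 (c s).2) =ᶠ[𝓝[Icc 0 1] t] (vmom F ∘ c) := by
        have := (hc.isSol t ht).continuousWithinAt.eventually (hF.eventually_contDiffAt_lag hp)
        filter_upwards [this] with s hs
        exact vertDeriv_eq_vmom hs
      have h6 := h4.congr_of_eventuallyEq_of_mem h5 ht
      rw [horDeriv_eq_hmom (hF.contDiffAt_lag hp), ← ha.eulerLagrange _ hp]
      exact h6

theorem expRel_iff {x v y : Euc n} : ExpRel F x v y ↔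
    ∃ c, IsOrbit a c ∧ c 0 = (x, v) ∧ (c 1).1 = y := by
  constructor
  · rintro ⟨γ, hγ, h0, hv, h1⟩
    exact ⟨_, hγ.isOrbit hF ha, by simp [h0, hv], h1⟩
  · rintro ⟨c, hc, h0, h1⟩
    refine ⟨_, hc.isGeodesic hF ha, by simp [h0], ?_, h1⟩
    rw [hc.derivWithin_eq (by simp), h0]

/-- The derivative of the conservation of energy. -/
theorem fderiv_lag_sprayField {p : Euc n × Euc n} (hp : p ∈ slit n) :
    fderiv ℝ (lag F) p (sprayField a p) = 0 := by
  have h1 := hF.fderiv_vmom_self hp (sprayField a p)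
  have h2 := ha.eulerLagrange p hp
  rw [fderiv_lag_apply]
  simp only [sprayField] at h1 ⊢
  rw [h2] at h1
  linarith

/-- Geodesics have constant speed. -/
theorem IsOrbit.speed_eq {c : ℝ → Euc n × Euc n} (hc : IsOrbit a c) {t : ℝ}
    (ht : t ∈ Icc (0 : ℝ) 1) : F (c t).1 (c t).2 = F (c 0).1 (c 0).2 := by
  have hd : ∀ t ∈ Icc (0 : ℝ) 1, HasDerivWithinAt (fun t => lag F (c t)) 0 (Icc 0 1) t := by
    intro t ht
    -- On the zero section the energy is only known to be at most quadratic in the velocity, which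
    -- suffices since the acceleration vanishes there.
    by_cases h0 : (c t).2 = 0
    · obtain ⟨m, M, hm, hM, hb⟩ := hF.exists_norm_bounds
      have h2 := HasDerivWithinAt.snd_pair (hc.isSol t ht)
      have h3 : c t = ((c t).1, 0) := by rw [← h0]
      simp only [sprayField] at h2
      rw [h3, ha.apply_zero] at h2
      obtain ⟨C, hC⟩ := isCompact_Icc.exists_bound_of_continuousOn hc.isSol.continuousOn
      have hM2 : 0 ≤ M ^ 2 / 2 := by positivity
      refine hasDerivWithinAt_zero_of_le (C := M ^ 2 / 2 * C) ht h2 h0 fun x hx => ?_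
      refine (hF.lag_le (fun z hz v => (hb z hz v).2) (hc.mapsTo hx) _).trans ?_
      rw [sq ‖_‖, ← mul_assoc]
      gcongr
      exact (norm_snd_le _).trans (hC x hx)
    · have hp : c t ∈ slit n := ⟨hc.mapsTo ht, h0⟩
      have := ((hF.contDiffAt_lag hp).differentiableAt (by simp)).hasFDerivAt.comp_hasDerivWithinAt
        t (hc.isSol t ht)
      rw [fderiv_lag_sprayField hF ha hp] at this
      exact this
  have h1 := constant_of_derivWithin_zero (fun t ht => (hd t ht).differentiableWithinAt)
    (fun t ht => (hd t (Ico_subset_Icc_self ht)).derivWithin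
      (uniqueDiff_Icc t (Ico_subset_Icc_self ht))) t ht
  simp only [lag] at h1
  have h2 := hF.nonneg (hc.mapsTo ht) (c t).2
  have h3 := hF.nonneg (hc.mapsTo (show (0 : ℝ) ∈ Icc (0 : ℝ) 1 by simp)) (c 0).2
  exact (sq_eq_sq₀ h2 h3).1 (by linarith)

theorem IsOrbit.mem_slit {c : ℝ → Euc n × Euc n} (hc : IsOrbit a c) (h0 : (c 0).2 ≠ 0) {t : ℝ}
    (ht : t ∈ Icc (0 : ℝ) 1) : c t ∈ slit n := by
  refine ⟨hc.mapsTo ht, fun h => ?_⟩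
  have h1 := hc.speed_eq hF ha ht
  rw [mem_singleton_iff.1 h, hF.apply_zero (hc.mapsTo ht)] at h1
  exact (hF.pos _ (hc.mapsTo (show (0 : ℝ) ∈ Icc (0 : ℝ) 1 by simp)) _ h0).ne h1

/-- Unlike the axiom `homog`, this allows negative factors, by reversibility; hence it holds only
over the ball. Reversing geodesics depends on it. -/
theorem spray_smul_cBall {z : Euc n} (hz : z ∈ cBall n) {r : ℝ} (hr : r ≠ 0) (v : Euc n) :
    a (z, r • v) = r ^ 2 • a (z, v) := by
  rcases eq_or_ne v 0 with rfl | hv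
  · simp [ha.apply_zero]
  have hp : (z, v) ∈ slit n := ⟨hz, hv⟩
  exact hF.spray_unique (IsReversibleFinsler.smul_mem_slit hp hr) (ha.eulerLagrange _ (IsReversibleFinsler.smul_mem_slit hp hr))
    (hF.spray_smul hp hr (ha.eulerLagrange _ hp))

/-- Affine reparametrizations of geodesics are geodesics. -/
theorem IsOrbit.reparam {c : ℝ → Euc n × Euc n} (hc : IsOrbit a c) {r s : ℝ}
    (hr : r ∈ Icc (0 : ℝ) 1) (hs : s ∈ Icc (0 : ℝ) 1) (hrs : r ≠ s) :
    IsOrbit a fun t => ((c (r + t * (s - r))).1, (s - r) • (c (r + t * (s - r))).2) := by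
  have hm : MapsTo (fun t : ℝ => r + t * (s - r)) (Icc 0 1) (Icc 0 1) := by
    intro t ht
    have := (convex_Icc (0 : ℝ) 1) hr hs (sub_nonneg.2 ht.2) ht.1 (by ring)
    convert this using 1
    simp only [smul_eq_mul]; ring
  refine ⟨fun t ht => ?_, fun t ht => hc.mapsTo (hm ht)⟩
  have h1 : HasDerivWithinAt (fun t : ℝ => r + t * (s - r)) (s - r) (Icc 0 1) t := by
    simpa using ((hasDerivWithinAt_id t _).mul_const (s - r)).const_add r
  have h2 : HasDerivWithinAt (fun t => c (r + t * (s - r))) _ (Icc 0 1) t :=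
    HasDerivWithinAt.scomp t (hc.isSol _ (hm ht)) h1 hm
  have h3 := (HasDerivWithinAt.fst_pair h2).prodMk
    ((HasDerivWithinAt.snd_pair h2).fun_const_smul (s - r))
  refine h3.congr_deriv ?_
  simp only [sprayField]
  rw [spray_smul_cBall hF ha (hc.mapsTo (hm ht)) (sub_ne_zero.2 hrs.symm)]
  simp [smul_smul, sq]

end

end FinslerBall

namespace FinslerBall

variable {n : ℕ}

/-! ### Convexity of the boundary and short geodesics -/

/-- A function on `[0,1]` that is non-negative at the endpoints and not too convex where it is
non-positive is non-negative. -/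
theorem nonneg_of_second_deriv_le {f g h : ℝ → ℝ}
    (hf : ∀ t ∈ Icc (0 : ℝ) 1, HasDerivWithinAt f (g t) (Icc 0 1) t)
    (hg : ∀ t ∈ Icc (0 : ℝ) 1, HasDerivWithinAt g (h t) (Icc 0 1) t)
    (h0 : 0 ≤ f 0) (h1 : 0 ≤ f 1)
    (hle : ∀ t ∈ Icc (0 : ℝ) 1, f t ≤ 0 → h t ≤ 1 / 4 * (|f t| + |g t|)) :
    ∀ t ∈ Icc (0 : ℝ) 1, 0 ≤ f t := by
  have hfc : ContinuousOn f (Icc 0 1) := fun t ht => (hf t ht).continuousWithinAt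
  have hgc : ContinuousOn g (Icc 0 1) := fun t ht => (hg t ht).continuousWithinAt
  by_contra! hcon
  obtain ⟨t', ht', hneg⟩ := hcon
  obtain ⟨a, ha, hmin⟩ := isCompact_Icc.exists_isMinOn ⟨t', ht'⟩ hfc
  have hfa : f a < 0 := (hmin ht').trans_lt hneg
  have ha0 : 0 < a := lt_of_le_of_ne ha.1 (by rintro rfl; linarith)
  have ha1 : a < 1 := lt_of_le_of_ne ha.2 (by rintro rfl; linarith)
  have hnhds : Icc (0 : ℝ) 1 ∈ 𝓝 a := Icc_mem_nhds ha0 ha1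
  have hga : g a = 0 := (hmin.isLocalMin hnhds).hasDerivAt_eq_zero ((hf a ha).hasDerivAt hnhds)
  -- the first time after `a` at which `f` is non-negative
  have hsub : Icc a 1 ⊆ Icc 0 1 := Icc_subset_Icc_left ha0.le
  have hcomp : IsCompact (Icc a 1 ∩ f ⁻¹' Ici 0) :=
    isCompact_Icc.of_isClosed_subset
      ((hfc.mono hsub).preimage_isClosed_of_isClosed isClosed_Icc isClosed_Ici) inter_subset_left
  obtain ⟨b, ⟨hb, hfb⟩, hleast⟩ := hcomp.exists_isLeast ⟨1, ⟨ha1.le, le_rfl⟩, h1⟩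
  have hsub2 : Icc a b ⊆ Icc 0 1 := Icc_subset_Icc ha0.le hb.2
  have hIci : ∀ {φ φ' : ℝ → ℝ}, (∀ t ∈ Icc (0 : ℝ) 1, HasDerivWithinAt φ (φ' t) (Icc 0 1) t) →
      ∀ t ∈ Ico a b, HasDerivWithinAt φ (φ' t) (Ici t) t := fun hφ t ht =>
    hasDerivWithinAt_Ici_of_Icc ⟨ha0.le.trans ht.1, ht.2.trans_le hb.2⟩
      (hφ t (hsub2 (Ico_subset_Icc_self ht)))
  -- Before `b` one has `|f| ≤ |f a|`. If `g` touched the barrier, then `|g| ≤ |f a| / 2`, so `h ≤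
  -- 3/8 * |f a|`, less than the slope of the barrier. Integrating over a time at most `1` leaves `f
  -- b ≤ f a / 2 < 0`.
  have hgB : ∀ t ∈ Icc a b, g t ≤ -f a / 2 * (t - a) := by
    refine fun t ht => image_le_of_deriv_right_lt_deriv_boundary (hgc.mono hsub2) (hIci hg)
      (B := fun t => -f a / 2 * (t - a)) (B' := fun _ => -f a / 2) (by simp [hga])
      (fun x => by simpa using ((hasDerivAt_id x).sub_const a).const_mul (-f a / 2)) ?_ ht
    intro t ht hgt
    have htI := hsub2 (Ico_subset_Icc_self ht)
    have hft : f t ≤ 0 := by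
      by_contra! hpos
      have := hleast ⟨⟨ht.1, htI.2⟩, hpos.le⟩
      exact absurd ht.2 (not_lt.2 this)
    have h3 := hle t htI hft
    have h4 : f a ≤ f t := hmin htI
    have h5 : 0 ≤ g t := by rw [hgt]; nlinarith [ht.1]
    have h6 : g t ≤ -f a / 2 := by rw [hgt]; nlinarith [htI.2]
    rw [abs_of_nonpos hft, abs_of_nonneg h5] at h3
    linarith
  have hfB : f b ≤ f a + -f a / 2 * (b - a) := by
    refine image_le_of_deriv_right_le_deriv_boundary (f := f) (B := fun t => f a + -f a / 2 * (t - a))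
      (hfc.mono hsub2) (hIci hf)
      (B' := fun _ => -f a / 2) (by simp) (by fun_prop)
      (fun x _ => by
        simpa using ((((hasDerivAt_id x).sub_const a).const_mul (-f a / 2)).const_add
          (f a)).hasDerivWithinAt)
      (fun t ht => ?_) (right_mem_Icc.2 hb.1)
    refine (hgB t (Ico_subset_Icc_self ht)).trans ?_
    have := (hsub2 (Ico_subset_Icc_self ht)).2
    nlinarith
  have : 0 ≤ f b := hfb
  have := hb.2
  nlinarith

section

variable {F : Euc n → Euc n → ℝ} {a : Euc n × Euc n → Euc n}

theorem isGeodesicAccel_spray (hF : IsReversibleFinsler F) (ha : IsGeodesicSpray F a)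
    {x v : Euc n} (hp : (x, v) ∈ slit n) : IsGeodesicAccel F x v (a (x, v)) := by
  set b := a (x, v)
  have h1 : HasDerivAt (fun t : ℝ => (x + t • v + (t ^ 2 / 2) • b, v + t • b)) (v, b) 0 := by
    have e1 : HasDerivAt (fun t : ℝ => t ^ 2 / 2) 0 0 := by
      simpa using (hasDerivAt_pow 2 (0 : ℝ)).div_const 2
    have e2 := (((hasDerivAt_id (0 : ℝ)).smul_const v).const_add x).add (e1.smul_const b)
    have e3 := ((hasDerivAt_id (0 : ℝ)).smul_const b).const_add v
    simpa using e2.prodMk e3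
  have h0 : (fun t : ℝ => (x + t • v + (t ^ 2 / 2) • b, v + t • b)) 0 = (x, v) := by simp
  have hL := hF.contDiffAt_lag hp
  have h2 : HasDerivAt (fun t : ℝ => vmom F (x + t • v + (t ^ 2 / 2) • b, v + t • b))
      (fderiv ℝ (vmom F) (x, v) (v, b)) 0 := by
    have h3 : HasFDerivAt (vmom F) (fderiv ℝ (vmom F) (x, v))
        (x + (0 : ℝ) • v + ((0 : ℝ) ^ 2 / 2) • b, v + (0 : ℝ) • b) := by
      simpa using hasFDerivAt_vmom hL
    exact h3.comp_hasDerivAt (0 : ℝ) h1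
  rw [ha.eulerLagrange _ hp, ← horDeriv_eq_hmom hL] at h2
  refine h2.congr_of_eventuallyEq ?_
  have h4 := hF.eventually_contDiffAt_lag hp
  rw [← h0] at h4
  filter_upwards [h1.continuousAt.eventually h4] with t ht
  exact vertDeriv_eq_vmom ht

theorem boundary_convex (hF : IsSimpleFinsler F) (ha : IsGeodesicSpray F a) {x v : Euc n}
    (hx : ‖x‖ = 1) (hv : inner ℝ x v = 0) : 0 ≤ ‖v‖ ^ 2 + inner ℝ x (a (x, v)) := by
  rcases eq_or_ne v 0 with rfl | h0
  · simp [ha.apply_zero]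
  · exact hF.convexBoundary x v _ hx h0 hv
      (isGeodesicAccel_spray hF.toIsReversibleFinsler ha ⟨by simp [hx], h0⟩)

theorem IsSpray.norm_sub_le (ha : IsSpray a) : ∃ C : ℝ, 0 ≤ C ∧ ∀ ρ : ℝ, ∀ p q : Euc n × Euc n,
    ‖p.2‖ ≤ ρ → ‖q.2‖ ≤ ρ → ‖a p‖ ≤ C * ρ ^ 2 ∧ ‖a q - a p‖ ≤ C * (ρ ^ 2 + ρ) * ‖q - p‖ := by
  obtain ⟨C₁, hC₁, h₁⟩ := ha.exists_bound
  obtain ⟨C₂, hC₂, h₂⟩ := ha.exists_fderiv_bound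
  refine ⟨max C₁ C₂, hC₁.trans (le_max_left _ _), fun ρ p q hp hq => ?_⟩
  have hρ : 0 ≤ ρ := (norm_nonneg _).trans hp
  constructor
  · refine (h₁ p).1.trans ?_
    gcongr
    exact le_max_left _ _
  · have hconv : Convex ℝ ((univ : Set (Euc n)) ×ˢ closedBall (0 : Euc n) ρ) :=
      convex_univ.prod (convex_closedBall _ _)
    refine hconv.norm_image_sub_le_of_norm_fderiv_le (𝕜 := ℝ)
      (fun r _ => ha.contDiff_one.differentiable one_ne_zero r) (fun r hr => (h₂ r).trans ?_)
      ⟨trivial, by simpa using hp⟩ ⟨trivial, by simpa using hq⟩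
    have : ‖r.2‖ ≤ ρ := by simpa using hr.2
    gcongr
    exact le_max_right _ _

/-- The second derivative of `(1 - ‖γ‖²)/2` along slow geodesics close to the boundary. -/
theorem exists_convexity_estimate (hF : IsSimpleFinsler F) (ha : IsGeodesicSpray F a) :
    ∃ ρ > 0, ∀ z v : Euc n, 1 ≤ ‖z‖ → ‖z‖ ≤ 2 → ‖v‖ ≤ ρ →
      -‖v‖ ^ 2 - inner ℝ z (a (z, v)) ≤ 1 / 4 * ((‖z‖ ^ 2 - 1) / 2 + |inner ℝ z v|) := by
  obtain ⟨C, hC0, hC⟩ := ha.norm_sub_le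
  obtain ⟨ρ, hρ, hρ1, hρ2⟩ : ∃ ρ : ℝ, 0 < ρ ∧ ρ ≤ 1 ∧ C * ρ ≤ 1 / 20 := by
    refine ⟨1 / (20 * (C + 1)), by positivity, ?_, ?_⟩
    · rw [div_le_one (by positivity)]; linarith
    · rw [mul_one_div, div_le_div_iff₀ (by positivity) (by norm_num)]; linarith
  -- The left side is at most `5 * C * ρ` because `ρ ≤ 1`; this explains the constant `1 / 20`.
  have hk : C * ρ ^ 2 + 2 * (C * (ρ ^ 2 + ρ)) ≤ 1 / 4 := by nlinarith
  refine ⟨ρ, hρ, fun z v hz1 hz2 hv => ?_⟩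
  have hz0 : ‖z‖ ≠ 0 := by linarith
  -- The pair `(z, v)` is compared with the tangent vector `(e, w)` of the sphere, where convexity
  -- applies. Their distance is at most `(‖z‖ - 1) + |s|`, and both terms are controlled by the
  -- right-hand side.
  set e : Euc n := ‖z‖⁻¹ • z with he
  have hze : z = ‖z‖ • e := by rw [he, smul_inv_smul₀ hz0]
  have he1 : ‖e‖ = 1 := by rw [he, norm_smul, norm_inv, norm_norm, inv_mul_cancel₀ hz0]
  set s : ℝ := inner ℝ e v with hs
  set w : Euc n := v - s • e with hw
  have hew : inner ℝ e w = 0 := by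
    rw [hw, inner_sub_right, inner_smul_right, real_inner_self_eq_norm_sq, he1]; simp [hs]
  have hvw : ‖v‖ ^ 2 = ‖w‖ ^ 2 + s ^ 2 := by
    have h1 : v = w + s • e := by rw [hw]; abel
    rw [h1, norm_add_sq_real, inner_smul_right, real_inner_comm, hew, norm_smul, he1]
    simp
  have hwρ : ‖w‖ ≤ ρ := by
    refine le_trans ?_ hv
    exact (sq_le_sq₀ (norm_nonneg _) (norm_nonneg _)).1 (by nlinarith)
  have hb := boundary_convex hF ha he1 hew
  obtain ⟨h1, h2⟩ := hC ρ (e, w) (z, v) hwρ hv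
  have hd1 : ‖z - e‖ = ‖z‖ - 1 := by
    have h3 : z - e = (‖z‖ - 1) • e := by rw [sub_smul, ← hze, one_smul]
    rw [h3, norm_smul, he1, mul_one, Real.norm_of_nonneg (by linarith)]
  have hd2 : ‖v - w‖ = |s| := by
    rw [hw, sub_sub_cancel, norm_smul, he1, mul_one, Real.norm_eq_abs]
  have hzv : inner ℝ z v = ‖z‖ * s := by
    rw [hs, hze, inner_smul_left, norm_smul, he1]; simp
  have hzs : |s| ≤ |inner ℝ z v| := by
    rw [hzv, abs_mul, abs_norm]
    nlinarith [abs_nonneg s]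
  have hd : ‖(z, v) - (e, w)‖ ≤ (‖z‖ - 1) + |s| := by
    rw [Prod.mk_sub_mk, Prod.norm_mk, hd1, hd2]
    exact max_le (by linarith [abs_nonneg s]) (by linarith)
  have h3 : -‖v‖ ^ 2 - inner ℝ z (a (z, v)) ≤
      -inner ℝ (z - e) (a (e, w)) - inner ℝ z (a (z, v) - a (e, w)) := by
    rw [inner_sub_left, inner_sub_right]
    nlinarith [sq_nonneg s]
  have h4 : -inner ℝ (z - e) (a (e, w)) ≤ (‖z‖ - 1) * (C * ρ ^ 2) := by
    refine (neg_le_abs _).trans ((abs_real_inner_le_norm _ _).trans ?_)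
    rw [hd1]
    exact mul_le_mul_of_nonneg_left h1 (by linarith)
  have h5 : -inner ℝ z (a (z, v) - a (e, w)) ≤
      2 * (C * (ρ ^ 2 + ρ) * ((‖z‖ - 1) + |s|)) := by
    refine (neg_le_abs _).trans ((abs_real_inner_le_norm _ _).trans ?_)
    refine mul_le_mul hz2 (h2.trans ?_) (norm_nonneg _) zero_le_two
    gcongr
  have h6 : ‖z‖ - 1 ≤ (‖z‖ ^ 2 - 1) / 2 := by nlinarith
  calc -‖v‖ ^ 2 - inner ℝ z (a (z, v))
      ≤ (‖z‖ - 1) * (C * ρ ^ 2) + 2 * (C * (ρ ^ 2 + ρ) * ((‖z‖ - 1) + |s|)) := by linarith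
    _ ≤ (C * ρ ^ 2 + 2 * (C * (ρ ^ 2 + ρ))) * ((‖z‖ - 1) + |s|) := by
        have : 0 ≤ |s| * (C * ρ ^ 2) := by positivity
        linarith
    _ ≤ 1 / 4 * ((‖z‖ ^ 2 - 1) / 2 + |inner ℝ z v|) := by
        refine mul_le_mul hk (by linarith) ?_ (by norm_num)
        have := abs_nonneg s
        linarith

/-- Slow solutions of the geodesic equation between points of the ball stay in the ball. -/
theorem mapsTo_cBall_of_slow {ρ : ℝ}
    (hρ : ∀ z v : Euc n, 1 ≤ ‖z‖ → ‖z‖ ≤ 2 → ‖v‖ ≤ ρ →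
      -‖v‖ ^ 2 - inner ℝ z (a (z, v)) ≤ 1 / 4 * ((‖z‖ ^ 2 - 1) / 2 + |inner ℝ z v|))
    {c : ℝ → Euc n × Euc n} (hc : IsSol (fun _ => sprayField a) c)
    (h0 : (c 0).1 ∈ cBall n) (h1 : (c 1).1 ∈ cBall n)
    (hc1 : ∀ t ∈ Icc (0 : ℝ) 1, ‖(c t).1‖ ≤ 2) (hc2 : ∀ t ∈ Icc (0 : ℝ) 1, ‖(c t).2‖ ≤ ρ) :
    MapsTo (fun t => (c t).1) (Icc 0 1) (cBall n) := by
  have hmem : ∀ z : Euc n, z ∈ cBall n ↔ 0 ≤ (1 - inner ℝ z z) / 2 := by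
    intro z
    rw [real_inner_self_eq_norm_sq, mem_closedBall_zero_iff]
    constructor
    · intro h; nlinarith [norm_nonneg z]
    · intro h; nlinarith [norm_nonneg z]
  have hd1 : ∀ t ∈ Icc (0 : ℝ) 1, HasDerivWithinAt (fun t => (c t).1) (c t).2 (Icc 0 1) t :=
    fun t ht => HasDerivWithinAt.fst_pair (hc t ht)
  have hd2 : ∀ t ∈ Icc (0 : ℝ) 1, HasDerivWithinAt (fun t => (c t).2) (a (c t)) (Icc 0 1) t :=
    fun t ht => HasDerivWithinAt.snd_pair (hc t ht)
  have key := nonneg_of_second_deriv_le (f := fun t => (1 - inner ℝ (c t).1 (c t).1) / 2)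
    (g := fun t => -inner ℝ (c t).1 (c t).2)
    (h := fun t => -‖(c t).2‖ ^ 2 - inner ℝ (c t).1 (a (c t)))
    (fun t ht => ?_) (fun t ht => ?_) ((hmem _).1 h0) ((hmem _).1 h1) (fun t ht hle => ?_)
  · exact fun t ht => (hmem _).2 (key t ht)
  · have := (((hd1 t ht).inner ℝ (hd1 t ht)).const_sub 1).div_const 2
    refine this.congr_deriv ?_
    rw [real_inner_comm (c t).1 (c t).2]; ring
  · have := ((hd1 t ht).inner ℝ (hd2 t ht)).neg
    refine this.congr_deriv ?_
    rw [real_inner_self_eq_norm_sq]; ring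
  · simp only [real_inner_self_eq_norm_sq] at hle ⊢
    have hz : 1 ≤ ‖(c t).1‖ := by nlinarith [norm_nonneg (c t).1]
    have := hρ (c t).1 (c t).2 hz (hc1 t ht) (hc2 t ht)
    rw [abs_of_nonpos hle, abs_neg]
    convert this using 3
    ring

theorem norm_pair_sub (p v w : Euc n) : ‖((p, v) : Euc n × Euc n) - (p, w)‖ = ‖v - w‖ := by
  rw [Prod.mk_sub_mk, sub_self, Prod.norm_mk, norm_zero, max_eq_right (norm_nonneg _)]

/-- The flow of slow geodesics. -/
theorem IsSpray.exists_slow_flow (ha : IsSpray a) : ∃ K > 0, ∃ ε > 0,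
    ∃ Φ : Euc n → Euc n → ℝ → Euc n × Euc n, ∀ p ∈ cBall n, ∀ v, ‖v‖ ≤ ε →
      Φ p v 0 = (p, v) ∧ IsSol (fun _ => sprayField a) (Φ p v) ∧
      (∀ t ∈ Icc (0 : ℝ) 1, ‖(Φ p v t).1‖ ≤ 2 ∧ ‖(Φ p v t).2‖ ≤ K * ‖v‖) ∧
      (Φ p 0 1).1 = p ∧
      ∀ w, ‖w‖ ≤ ε → ∀ t ∈ Icc (0 : ℝ) 1, ‖Φ p v t - Φ p w t‖ ≤ K * ‖v - w‖ := by
  obtain ⟨X, hX, hXs, hXe⟩ := ha.exists_cutoff (R := 2) two_pos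
  obtain ⟨Φ, hΦ0, hΦ, ⟨K, hK⟩, -⟩ := exists_flow hX hXs
  obtain ⟨L, hL⟩ := hX.lipschitzWith_of_hasCompactSupport hXs one_ne_zero
  have hconst : ∀ p ∈ cBall n, ∀ t ∈ Icc (0 : ℝ) 1, Φ (p, 0) t = (p, 0) := by
    intro p hp
    refine IsSol.eqOn (s := univ) (f := fun _ => X) (β := fun _ => (p, 0))
      (fun t _ => hL.lipschitzOnWith) (hΦ _) (fun t ht => ?_) (mapsTo_univ _ _) (mapsTo_univ _ _)
      (hΦ0 _)
    have h1 : ‖(p, (0 : Euc n))‖ ≤ 2 := by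
      rw [Prod.norm_mk, norm_zero]
      exact max_le (by linarith [mem_closedBall_zero_iff.1 hp]) zero_le_two
    have h2 : X (p, 0) = 0 := by
      rw [(hXe _ h1).1, sprayField, ha.apply_zero]; rfl
    simp only [h2]
    exact hasDerivWithinAt_const _ _ _
  have hbd : ∀ p ∈ cBall n, ∀ v, ∀ t ∈ Icc (0 : ℝ) 1,
      ‖Φ (p, v) t - (p, 0)‖ ≤ (K + 1) * ‖v‖ := by
    intro p hp v t ht
    have := hK (p, v) (p, 0) t ht
    rw [hconst p hp t ht, dist_eq_norm, dist_eq_norm, norm_pair_sub, sub_zero] at this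
    nlinarith [norm_nonneg v]
  have hK0 : (0 : ℝ) ≤ K := K.coe_nonneg
  -- This bound on `‖v‖` keeps the solution within distance `1` of `(p, 0)`, hence in the region of
  -- norm at most `2` that the cutoff leaves unchanged.
  refine ⟨K + 1, by positivity, (K + 1 : ℝ)⁻¹, by positivity, fun p v => Φ (p, v),
    fun p hp v hv => ?_⟩
  have hKv : (K + 1) * ‖v‖ ≤ 1 := by
    calc (K + 1) * ‖v‖ ≤ (K + 1) * (K + 1 : ℝ)⁻¹ := by gcongr
      _ = 1 := mul_inv_cancel₀ (by positivity)
  have hn : ∀ t ∈ Icc (0 : ℝ) 1, ‖(Φ (p, v) t).1‖ ≤ 2 ∧ ‖(Φ (p, v) t).2‖ ≤ (K + 1) * ‖v‖ := by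
    intro t ht
    have h1 := hbd p hp v t ht
    have h2 := (norm_fst_le _).trans h1
    have h3 := (norm_snd_le _).trans h1
    simp only [Prod.fst_sub, Prod.snd_sub, sub_zero] at h2 h3
    refine ⟨?_, h3⟩
    have h4 := norm_le_insert' (Φ (p, v) t).1 p
    have h5 := mem_closedBall_zero_iff.1 hp
    linarith
  refine ⟨hΦ0 _, fun t ht => ?_, hn, by simp only [hconst p hp 1 (by simp)], fun w _ t ht => ?_⟩
  · have h1 := hΦ (p, v) t ht
    have h2 : ‖Φ (p, v) t‖ ≤ 2 := max_le (hn t ht).1 ((hn t ht).2.trans (by linarith))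
    simp only at h1 ⊢
    rwa [(hXe _ h2).1] at h1
  · have := hK (p, v) (p, w) t ht
    rw [dist_eq_norm, dist_eq_norm, norm_pair_sub] at this
    exact this.trans (by nlinarith [norm_nonneg (v - w)])

/-- Close points of the ball are connected by short geodesics. -/
theorem exists_short_geodesic (hF : IsSimpleFinsler F) (ha : IsGeodesicSpray F a) :
    ∃ δ > 0, ∀ p ∈ cBall n, ∀ q ∈ cBall n, ‖q - p‖ ≤ δ →
      ∃ c, IsOrbit a c ∧ (c 0).1 = p ∧ (c 1).1 = q ∧ ‖(c 0).2‖ ≤ 2 * ‖q - p‖ := by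
  obtain ⟨ρ, hρ, hconv⟩ := exists_convexity_estimate hF ha
  obtain ⟨C, hC0, hC⟩ := ha.norm_sub_le
  obtain ⟨K, hK, ε₀, hε₀, Φ, hΦ⟩ := ha.exists_slow_flow
  obtain ⟨ε, hε, hεε₀, hερ, hεC⟩ : ∃ ε > 0, ε ≤ ε₀ ∧ K * ε ≤ ρ ∧
      C * ((K * ε) ^ 2 + K * ε) * K ≤ 1 / 2 := by
    have h1 : Continuous fun ε : ℝ => C * ((K * ε) ^ 2 + K * ε) * K := by fun_prop
    have h2 : Continuous fun ε : ℝ => K * ε := by fun_prop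
    have e1 : ∀ᶠ ε in 𝓝 (0 : ℝ), C * ((K * ε) ^ 2 + K * ε) * K ≤ 1 / 2 :=
      (h1.tendsto 0).eventually (eventually_le_nhds (by simp))
    have e2 : ∀ᶠ ε in 𝓝 (0 : ℝ), K * ε ≤ ρ :=
      (h2.tendsto 0).eventually (eventually_le_nhds (by simpa using hρ))
    have e3 : ∀ᶠ ε in 𝓝 (0 : ℝ), ε ≤ ε₀ := eventually_le_nhds hε₀
    obtain ⟨ε, ⟨⟨h1, h2⟩, h3⟩, h4⟩ := (((e1.and e2).and e3).filter_mono
      (nhdsWithin_le_nhds (s := Ioi 0))).and self_mem_nhdsWithin |>.exists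
    exact ⟨ε, h4, h3, h2, h1⟩
  -- For slow velocities the endpoint differs from `p + v` by a map with Lipschitz constant `1/2`.
  -- The quantitative inverse function theorem then reaches every point within `ε / 2` of `p`.
  have hlin : ∀ p ∈ cBall n, ∀ v w, ‖v‖ ≤ ε → ‖w‖ ≤ ε →
      ‖(Φ p v 1).1 - (Φ p w 1).1 - (v - w)‖ ≤ 1 / 2 * ‖v - w‖ := by
    intro p hp v w hv hw
    obtain ⟨hv0, hvs, hvb, -, hvw⟩ := hΦ p hp v (hv.trans hεε₀)
    obtain ⟨hw0, hws, hwb, -, -⟩ := hΦ p hp w (hw.trans hεε₀)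
    have hvel : ∀ t ∈ Icc (0 : ℝ) 1,
        ‖(Φ p v t).2 - (Φ p w t).2 - (v - w)‖ ≤ 1 / 2 * ‖v - w‖ := by
      intro t ht
      have h1 := norm_image_sub_le_of_norm_deriv_le_segment' (a := 0) (b := 1)
        (f := fun t => (Φ p v t).2 - (Φ p w t).2) (C := 1 / 2 * ‖v - w‖)
        (fun t ht => (HasDerivWithinAt.snd_pair (hvs t ht)).fun_sub
          (HasDerivWithinAt.snd_pair (hws t ht)))
        (fun t ht => ?_) t ht
      · simp only [hv0, hw0, sub_zero] at h1
        refine h1.trans ?_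
        exact mul_le_of_le_one_right (by positivity) ht.2
      · have ht' := Ico_subset_Icc_self ht
        have h2 := (hC (K * ε) (Φ p w t) (Φ p v t)
          ((hwb t ht').2.trans (by gcongr)) ((hvb t ht').2.trans (by gcongr))).2
        refine h2.trans ?_
        calc C * ((K * ε) ^ 2 + K * ε) * ‖Φ p v t - Φ p w t‖
            ≤ C * ((K * ε) ^ 2 + K * ε) * (K * ‖v - w‖) := by
              gcongr
              exact hvw w (hw.trans hεε₀) t ht'
          _ = C * ((K * ε) ^ 2 + K * ε) * K * ‖v - w‖ := by ring
          _ ≤ _ := by gcongr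
    have h1 := norm_image_sub_le_of_norm_deriv_le_segment' (a := 0) (b := 1)
      (f := fun t => (Φ p v t).1 - (Φ p w t).1 - t • (v - w)) (C := 1 / 2 * ‖v - w‖)
      (fun t ht => ((HasDerivWithinAt.fst_pair (hvs t ht)).fun_sub
        (HasDerivWithinAt.fst_pair (hws t ht))).fun_sub
        ((hasDerivWithinAt_id t _).smul_const (v - w)))
      (fun t ht => ?_) 1 (by simp)
    · simpa [hv0, hw0] using h1
    · have := hvel t (Ico_subset_Icc_self ht)
      simpa [sprayField] using this
  refine ⟨ε / 2, by positivity, fun p hp q hq hpq => ?_⟩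
  have hΦ00 : (Φ p 0 1).1 = p := (hΦ p hp 0 (by simpa using hε₀.le)).2.2.2.1
  have happ : ApproximatesLinearOn (fun v => (Φ p v 1).1)
      (ContinuousLinearMap.id ℝ (Euc n)) (closedBall 0 ε) (1 / 2) := by
    intro v hv w hw
    simpa using hlin p hp v w (by simpa using hv) (by simpa using hw)
  let inv : (ContinuousLinearMap.id ℝ (Euc n)).NonlinearRightInverse :=
    ⟨id, 1, fun y => by simp, fun y => rfl⟩
  have hsurj := happ.surjOn_closedBall_of_nonlinearRightInverse inv hε.le subset_rfl
  have hq' : q ∈ closedBall (Φ p 0 1).1 ((((inv.nnnorm : ℝ))⁻¹ - (1 / 2 : NNReal)) * ε) := by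
    rw [hΦ00, mem_closedBall, dist_eq_norm]
    refine hpq.trans (le_of_eq ?_)
    simp only [inv]
    norm_num
    ring
  obtain ⟨v, hv, hvq⟩ := hsurj hq'
  have hv' : ‖v‖ ≤ ε := by simpa using hv
  simp only at hvq
  obtain ⟨hv0, hvs, hvb, -, -⟩ := hΦ p hp v (hv'.trans hεε₀)
  refine ⟨Φ p v, ⟨hvs, mapsTo_cBall_of_slow hconv hvs (by rw [hv0]; exact hp)
    (by rw [hvq]; exact hq) (fun t ht => (hvb t ht).1)
    (fun t ht => (hvb t ht).2.trans (le_trans (by gcongr) hερ))⟩, by rw [hv0], hvq, ?_⟩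
  -- Comparison with the constant solution gives `‖q - p - v‖ ≤ ‖v‖ / 2`, hence the factor `2`.
  have h1 := hlin p hp v 0 hv' (by simpa using hε.le)
  rw [hΦ00, hvq, sub_zero] at h1
  have h2 := norm_sub_norm_le v (q - p)
  rw [norm_sub_rev v] at h2
  rw [hv0]
  simp only
  linarith

end

end FinslerBall

namespace FinslerBall

variable {n : ℕ}

/-! ### Boundedness of geodesics -/

section

variable {F : Euc n → Euc n → ℝ} (hF : IsSimpleFinsler F) {a : Euc n × Euc n → Euc n}
  (ha : IsGeodesicSpray F a)
include hF ha

theorem IsOrbit.initial_eq {c d : ℝ → Euc n × Euc n} (hc : IsOrbit a c) (hd : IsOrbit a d)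
    (h0 : (c 0).1 = (d 0).1) (h1 : (c 1).1 = (d 1).1) (hne : (c 0).1 ≠ (c 1).1) : c 0 = d 0 := by
  have m0 : (0 : ℝ) ∈ Icc (0 : ℝ) 1 := by simp
  have m1 : (1 : ℝ) ∈ Icc (0 : ℝ) 1 := by simp
  obtain ⟨γ, -, -, -, huniq⟩ := hF.uniqueGeodesic _ (hc.mapsTo m0) _ (hc.mapsTo m1) hne
  have e1 := huniq _ (hc.isGeodesic hF.toIsReversibleFinsler ha) rfl rfl
  have e2 := huniq _ (hd.isGeodesic hF.toIsReversibleFinsler ha) h0.symm h1.symm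
  have e3 : EqOn (fun t => (c t).1) (fun t => (d t).1) (Icc 0 1) := e1.trans e2.symm
  refine Prod.ext h0 ?_
  rw [← hc.derivWithin_eq m0, ← hd.derivWithin_eq m0]
  exact derivWithin_congr e3 (e3 m0)

/-- There are no geodesic loops. -/
theorem IsOrbit.velocity_eq_zero_of_loop {c : ℝ → Euc n × Euc n} (hc : IsOrbit a c)
    (h : (c 0).1 = (c 1).1) : (c 0).2 = 0 := by
  by_contra hv
  have hF' := hF.toIsReversibleFinsler
  have m0 : (0 : ℝ) ∈ Icc (0 : ℝ) 1 := by simp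
  have m1 : (1 : ℝ) ∈ Icc (0 : ℝ) 1 := by simp
  -- Such a point cuts the loop into two geodesics from the base point to the same other point, the
  -- second run backwards. Uniqueness equates their speeds, which are proportional to `s` and `1 -
  -- s`; but `s < 1 / 2`.
  obtain ⟨s, hs0, hs1, hs⟩ : ∃ s : ℝ, 0 < s ∧ s < 1 / 2 ∧ (c s).1 ≠ (c 0).1 := by
    have hd : HasDerivWithinAt (fun t => (c t).1) (c 0).2 (Icc 0 1) 0 :=
      HasDerivWithinAt.fst_pair (hc.isSol 0 m0)
    have h2 : Icc (0 : ℝ) 1 \ {0} = Ioc 0 1 := Icc_sdiff_left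
    have h3 := hd.eventually_ne (c := (c 0).1) hv
    rw [h2, nhdsWithin_Ioc_eq_nhdsGT one_pos] at h3
    obtain ⟨s, hs, hs'⟩ := (h3.and (Ioo_mem_nhdsGT (show (0 : ℝ) < 1 / 2 by norm_num))).exists
    exact ⟨s, hs'.1, hs'.2, hs⟩
  have ms : s ∈ Icc (0 : ℝ) 1 := ⟨hs0.le, by linarith⟩
  have o1 := hc.reparam hF' ha m0 ms hs0.ne
  have o2 := hc.reparam hF' ha m1 ms (by linarith)
  have e := o1.initial_eq hF ha o2 (by simpa using h) (by simp) (by simpa using hs.symm)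
  have e2 := congrArg (fun p : Euc n × Euc n => F p.1 p.2) e
  simp only [zero_mul, add_zero, sub_zero] at e2
  rw [hF'.homog _ (hc.mapsTo m0), hF'.homog _ (hc.mapsTo m1), hc.speed_eq hF' ha m1,
    abs_of_pos hs0, abs_of_neg (by linarith)] at e2
  have hpos := hF'.pos _ (hc.mapsTo m0) _ hv
  have := mul_right_cancel₀ hpos.ne' e2
  linarith

/-- The lengths of the geodesics in the ball are bounded. -/
theorem exists_orbit_bound : ∃ R > 0, ∀ c, IsOrbit a c → ∀ t ∈ Icc (0 : ℝ) 1, ‖c t‖ ≤ R := by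
  have hF' := hF.toIsReversibleFinsler
  obtain ⟨m, M, hm, hM, hb⟩ := hF'.exists_norm_bounds
  obtain ⟨δ, hδ, hshort⟩ := exists_short_geodesic hF ha
  obtain ⟨T, -, hTf, hT⟩ := (isCompact_closedBall (0 : Euc n) 1).finite_cover_balls
    (show 0 < δ / 2 by positivity)
  have hT' : ∀ z ∈ cBall n, ∃ x ∈ T, z ∈ ball x (δ / 2) := fun z hz => by
    simpa using hT hz
  choose! φ hφT hφ using hT'
  set N : ℕ := hTf.toFinset.card + 1 with hN
  have hN0 : (0 : ℝ) < N := by positivity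
  have m0 : (0 : ℝ) ∈ Icc (0 : ℝ) 1 := by simp
  have hspeed : ∀ c, IsOrbit a c → F (c 0).1 (c 0).2 ≤ 2 * M * δ * N := by
    intro c hc
    have hS0 : 0 ≤ F (c 0).1 (c 0).2 := hF'.nonneg (hc.mapsTo m0) _
    have hmem : ∀ i ∈ Finset.range (N + 1), (i / N : ℝ) ∈ Icc (0 : ℝ) 1 := by
      intro i hi
      have : (i : ℝ) ≤ N := by exact_mod_cast Nat.lt_succ_iff.1 (Finset.mem_range.1 hi)
      exact ⟨by positivity, by rw [div_le_one hN0]; exact this⟩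
    -- Two of the `N + 1` equally spaced times land in the same ball of the cover. The arc between
    -- them takes time at least `1 / N` and must be the short geodesic between its endpoints, or a
    -- loop; either way the speed is bounded.
    obtain ⟨i, hi, j, hj, hij, hφij⟩ := Finset.exists_ne_map_eq_of_card_lt_of_maps_to
      (s := Finset.range (N + 1)) (t := hTf.toFinset) (f := fun i : ℕ => φ (c (i / N)).1)
      (by simp [hN]) (fun i hi => by simpa using hφT _ (hc.mapsTo (hmem i hi)))
    set r : ℝ := i / N
    set s : ℝ := j / N
    have hr := hmem i hi
    have hs := hmem j hj
    have hrs : 1 / N ≤ |s - r| := by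
      rw [show s - r = ((j : ℝ) - i) / N by simp only [r, s]; ring, abs_div, abs_of_pos hN0]
      gcongr
      have : (1 : ℤ) ≤ |(j : ℤ) - i| := Int.one_le_abs (sub_ne_zero.2 (by exact_mod_cast hij.symm))
      exact_mod_cast this
    have hrs0 : r ≠ s := by
      intro h
      rw [h, sub_self, abs_zero] at hrs
      have : 0 < 1 / (N : ℝ) := by positivity
      linarith
    have hclose : ‖(c s).1 - (c r).1‖ ≤ δ := by
      have e1 := hφ _ (hc.mapsTo hr)
      have e2 := hφ _ (hc.mapsTo hs)
      rw [← hφij] at e2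
      rw [← dist_eq_norm]
      have := dist_triangle_right (c s).1 (c r).1 (φ (c r).1)
      rw [mem_ball] at e1 e2
      linarith
    have hd := hc.reparam hF' ha hr hs hrs0
    have hdF : F (c r).1 ((s - r) • (c r).2) = |s - r| * F (c 0).1 (c 0).2 := by
      rw [hF'.homog _ (hc.mapsTo hr), hc.speed_eq hF' ha hr]
    have key : |s - r| * F (c 0).1 (c 0).2 ≤ 2 * M * δ := by
      by_cases heq : (c r).1 = (c s).1
      · have h0 := hd.velocity_eq_zero_of_loop hF ha (by simpa using heq)
        simp only [zero_mul, add_zero] at h0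
        rw [h0, hF'.apply_zero (hc.mapsTo hr)] at hdF
        rw [← hdF]
        positivity
      · obtain ⟨e, he, he0, he1, hev⟩ := hshort _ (hc.mapsTo hr) _ (hc.mapsTo hs) hclose
        have h0 := hd.initial_eq hF ha he (by simpa using he0.symm) (by simpa using he1.symm)
          (by simpa using heq)
        have h1 := congrArg Prod.snd h0
        simp only [zero_mul, add_zero] at h1
        rw [← hdF, h1]
        refine (hb _ (hc.mapsTo hr) _).2.trans ?_
        have : ‖(e 0).2‖ ≤ 2 * δ := by linarith
        nlinarith
    have h2 : 1 / N * F (c 0).1 (c 0).2 ≤ 2 * M * δ := le_trans (by gcongr) key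
    rw [one_div, inv_mul_le_iff₀ hN0] at h2
    linarith
  refine ⟨max 1 (2 * M * δ * N / m), by positivity, fun c hc t ht => ?_⟩
  refine max_le_max (by simpa using hc.mapsTo ht) ?_
  rw [le_div_iff₀ hm, mul_comm]
  refine ((hb _ (hc.mapsTo ht) _).1.trans (le_of_eq (hc.speed_eq hF' ha ht))).trans (hspeed c hc)

/-- Uniqueness of orbits makes the chosen value of `expMap` the true endpoint, and existence of a
connecting geodesic puts `y` in its image, so neither default value intervenes. -/
theorem expInv_spec {x y : Euc n} (hx : x ∈ cBall n) (hy : y ∈ cBall n) (hxy : x ≠ y) :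
    ∃ c, IsOrbit a c ∧ c 0 = (x, expInv F x y) ∧ (c 1).1 = y := by
  have hF' := hF.toIsReversibleFinsler
  have huniq : ∀ {v z z'}, ExpRel F x v z → ExpRel F x v z' → z = z' := by
    intro v z z' h h'
    obtain ⟨c, hc, hc0, rfl⟩ := (expRel_iff hF' ha).1 h
    obtain ⟨d, hd, hd0, rfl⟩ := (expRel_iff hF' ha).1 h'
    rw [ha.isSol_unique hc.isSol hd.isSol (hc0.trans hd0.symm) (by simp)]
  have hmap : ∀ {v z}, ExpRel F x v z → expMap F x v = z := by
    intro v z h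
    have hex : ∃ z, ExpRel F x v z := ⟨z, h⟩
    rw [expMap, dif_pos hex]
    exact huniq hex.choose_spec h
  obtain ⟨γ, hγ, h0, h1, -⟩ := hF.uniqueGeodesic x hx y hy hxy
  have hrel : ExpRel F x (derivWithin γ (Icc 0 1) 0) y := ⟨γ, hγ, h0, rfl, h1⟩
  have himg : y ∈ expMap F x '' expDomain F x := ⟨_, ⟨y, hrel⟩, hmap hrel⟩
  obtain ⟨z, hz⟩ : expInv F x y ∈ expDomain F x := Function.invFunOn_mem himg
  have hz' : expMap F x (expInv F x y) = y := Function.invFunOn_eq himg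
  rw [hmap hz] at hz'
  subst hz'
  exact (expRel_iff hF' ha).1 hz

theorem expInv_eq {c : ℝ → Euc n × Euc n} (hc : IsOrbit a c) (hne : (c 0).1 ≠ (c 1).1) :
    expInv F (c 0).1 (c 1).1 = (c 0).2 := by
  obtain ⟨d, hd, hd0, hd1⟩ := expInv_spec hF ha (hc.mapsTo (show (0 : ℝ) ∈ Icc (0 : ℝ) 1 by simp))
    (hc.mapsTo (show (1 : ℝ) ∈ Icc (0 : ℝ) 1 by simp)) hne
  have := hd.initial_eq hF ha hc (by rw [hd0]) hd1 (by rw [hd0, hd1]; exact hne)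
  rw [hd0] at this
  exact congrArg Prod.snd this

end

/-! ### Jacobi fields -/

section

variable {F : Euc n → Euc n → ℝ} (hF : IsReversibleFinsler F) {a : Euc n × Euc n → Euc n}
  (ha : IsGeodesicSpray F a)

theorem IsSpray.hasFDerivAt_sprayField (ha : IsSpray a) (p : Euc n × Euc n) :
    HasFDerivAt (sprayField a) (fderiv ℝ (sprayField a) p) p :=
  (ha.contDiff_sprayField.differentiable one_ne_zero p).hasFDerivAt

theorem IsSpray.fderiv_sprayField_fst (ha : IsSpray a) (p w : Euc n × Euc n) :
    (fderiv ℝ (sprayField a) p w).1 = w.2 := by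
  have h : HasFDerivAt (sprayField a) ((ContinuousLinearMap.snd ℝ (Euc n) (Euc n)).prod
      (fderiv ℝ a p)) p :=
    hasFDerivAt_snd.prodMk (ha.contDiff_one.differentiable one_ne_zero p).hasFDerivAt
  rw [h.fderiv]; rfl

include hF ha

/-- The spray equation is differentiated in the direction `w`, and symmetry of the second derivative
of `vmom` moves `w` to the last slot. This is the Jacobi equation in first-order form. -/
theorem linearized_eulerLagrange {p : Euc n × Euc n} (hp : p ∈ slit n) (w : Euc n × Euc n) :
    fderiv ℝ (fderiv ℝ (vmom F)) p (sprayField a p) w +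
      fderiv ℝ (vmom F) p (fderiv ℝ (sprayField a) p w) = fderiv ℝ (hmom F) p w := by
  have hV := contDiffAt_vmom (hF.contDiffAt_lag hp)
  have h1 : HasFDerivAt (fderiv ℝ (vmom F)) (fderiv ℝ (fderiv ℝ (vmom F)) p) p :=
    ((hV.fderiv_right (m := ∞) (by simp)).differentiableAt (by simp)).hasFDerivAt
  have h2 := h1.clm_apply (ha.hasFDerivAt_sprayField p)
  have h3 := fderiv_eq_of_eqOn_slit hp h2.differentiableAt
    ((contDiffAt_hmom (hF.contDiffAt_lag hp)).differentiableAt (by simp))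
    (fun q hq => ha.eulerLagrange q hq)
  rw [h2.fderiv] at h3
  rw [← h3, ((contDiffAt_infty.1 hV 2).isSymmSndFDerivAt (by simp)).eq]
  simp [add_comm]

theorem linearized_energy {p : Euc n × Euc n} (hp : p ∈ slit n) (w : Euc n × Euc n) :
    fderiv ℝ (fderiv ℝ (lag F)) p (sprayField a p) w +
      fderiv ℝ (lag F) p (fderiv ℝ (sprayField a) p w) = 0 := by
  have hL := hF.contDiffAt_lag hp
  have h1 : HasFDerivAt (fderiv ℝ (lag F)) (fderiv ℝ (fderiv ℝ (lag F)) p) p :=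
    ((hL.fderiv_right (m := ∞) (by simp)).differentiableAt (by simp)).hasFDerivAt
  have h2 := h1.clm_apply (ha.hasFDerivAt_sprayField p)
  have h3 := fderiv_eq_of_eqOn_slit hp h2.differentiableAt (differentiableAt_const (0 : ℝ))
    (fun q hq => fderiv_lag_sprayField hF ha hq)
  rw [h2.fderiv, fderiv_fun_const] at h3
  rw [((contDiffAt_infty.1 hL 2).isSymmSndFDerivAt (by simp)).eq]
  have h4 := congrArg (fun l => l w) h3
  simpa [add_comm] using h4

variable {c Y : ℝ → Euc n × Euc n} (hc : IsOrbit a c) (hcs : ∀ t ∈ Icc (0 : ℝ) 1, c t ∈ slit n)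
  (hY : IsSol (fun t => fderiv ℝ (sprayField a) (c t)) Y)
include hc hcs hY

omit hc hcs hF in
theorem hasDerivWithinAt_linearized_fst {t : ℝ} (ht : t ∈ Icc (0 : ℝ) 1) :
    HasDerivWithinAt (fun t => (Y t).1) (Y t).2 (Icc 0 1) t := by
  have := HasDerivWithinAt.fst_pair (hY t ht)
  rwa [ha.fderiv_sprayField_fst] at this

theorem isJacobiField_linearized : IsJacobiField F (fun t => (c t).1) fun t => (Y t).1 := by
  have hd : EqOn (derivWithin (fun t => (Y t).1) (Icc 0 1)) (fun t => (Y t).2) (Icc 0 1) :=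
    fun t ht => (hasDerivWithinAt_linearized_fst ha hY ht).derivWithin (uniqueDiff_Icc t ht)
  have hfc : Continuous (fderiv ℝ (sprayField a)) :=
    ha.contDiff_sprayField.continuous_fderiv one_ne_zero
  have hY1 : ContDiffOn ℝ 1 Y (Icc 0 1) := by
    rw [show (1 : WithTop ℕ∞) = 0 + 1 by norm_num, contDiffOn_succ_iff_derivWithin uniqueDiff_Icc]
    refine ⟨fun t ht => (hY t ht).differentiableWithinAt, by simp, ?_⟩
    rw [contDiffOn_zero]
    refine ContinuousOn.congr (f := fun t => fderiv ℝ (sprayField a) (c t) (Y t)) ?_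
      (fun t ht => (hY t ht).derivWithin (uniqueDiff_Icc t ht))
    exact (hfc.comp_continuousOn hc.isSol.continuousOn).clm_apply hY.continuousOn
  refine ⟨?_, fun t ht => ?_⟩
  · rw [show (2 : WithTop ℕ∞) = 1 + 1 by norm_num, contDiffOn_succ_iff_derivWithin uniqueDiff_Icc]
    refine ⟨fun t ht => (hasDerivWithinAt_linearized_fst ha hY ht).differentiableWithinAt,
      by simp, ?_⟩
    exact (contDiff_snd.comp_contDiffOn hY1).congr hd
  · have hfun : ∀ s ∈ Icc (0 : ℝ) 1,
        fderiv ℝ (fun p : Euc n × Euc n => vertDeriv F p.1 p.2)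
          ((c s).1, derivWithin (fun t => (c t).1) (Icc 0 1) s)
          ((Y s).1, derivWithin (fun t => (Y t).1) (Icc 0 1) s) =
        fderiv ℝ (vmom F) (c s) (Y s) := fun s hs => by
      rw [hd hs, hc.derivWithin_eq hs, hF.fderiv_vertDeriv (hcs s hs)]
    refine HasDerivWithinAt.congr ?_ hfun (hfun t ht)
    rw [hd ht, hc.derivWithin_eq ht, hF.fderiv_horDeriv (hcs t ht),
      ← linearized_eulerLagrange hF ha (hcs t ht)]
    have h1 : HasFDerivAt (fderiv ℝ (vmom F)) (fderiv ℝ (fderiv ℝ (vmom F)) (c t)) (c t) :=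
      (((contDiffAt_vmom (hF.contDiffAt_lag (hcs t ht))).fderiv_right (m := ∞)
        (by simp)).differentiableAt (by simp)).hasFDerivAt
    have h2 : HasDerivWithinAt (fun s => fderiv ℝ (vmom F) (c s))
        (fderiv ℝ (fderiv ℝ (vmom F)) (c t) (sprayField a (c t))) (Icc 0 1) t :=
      HasFDerivAt.comp_hasDerivWithinAt (E := Euc n × Euc n →L[ℝ] Euc n →L[ℝ] ℝ) t h1
        (hc.isSol t ht)
    exact h2.clm_apply (hY t ht)

/-- The Gauss lemma. -/
theorem gauss_lemma (hY0 : (Y 0).1 = 0) : vmom F (c 1) (Y 1).1 = vmom F (c 0) (Y 0).2 := by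
  have m0 : (0 : ℝ) ∈ Icc (0 : ℝ) 1 := by simp
  have m1 : (1 : ℝ) ∈ Icc (0 : ℝ) 1 := by simp
  have he : ∀ t ∈ Icc (0 : ℝ) 1, HasDerivWithinAt (fun t => fderiv ℝ (lag F) (c t) (Y t)) 0
      (Icc 0 1) t := by
    intro t ht
    have h1 : HasFDerivAt (fderiv ℝ (lag F)) (fderiv ℝ (fderiv ℝ (lag F)) (c t)) (c t) :=
      (((hF.contDiffAt_lag (hcs t ht)).fderiv_right (m := ∞)
        (by simp)).differentiableAt (by simp)).hasFDerivAt
    have h2 := (h1.comp_hasDerivWithinAt t (hc.isSol t ht)).clm_apply (hY t ht)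
    exact h2.congr_deriv (linearized_energy hF ha (hcs t ht) (Y t))
  have hconst : ∀ t ∈ Icc (0 : ℝ) 1, fderiv ℝ (lag F) (c t) (Y t) = fderiv ℝ (lag F) (c 0) (Y 0) :=
    constant_of_derivWithin_zero (fun t ht => (he t ht).differentiableWithinAt)
      (fun t ht => (he t (Ico_subset_Icc_self ht)).derivWithin
        (uniqueDiff_Icc t (Ico_subset_Icc_self ht)))
  have he0 : fderiv ℝ (lag F) (c 0) (Y 0) = vmom F (c 0) (Y 0).2 := by
    rw [fderiv_lag_apply, hY0, map_zero, zero_add]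
  -- The momentum paired with the Jacobi field has as derivative the variation of the energy, which
  -- is conserved and equals its value at time `0`. The pairing is therefore linear in time.
  have hq : ∀ t ∈ Icc (0 : ℝ) 1, HasDerivWithinAt
      (fun t => vmom F (c t) (Y t).1 - t * vmom F (c 0) (Y 0).2) 0 (Icc 0 1) t := by
    intro t ht
    have h1 := (hasFDerivAt_vmom (hF.contDiffAt_lag (hcs t ht))).comp_hasDerivWithinAt t
      (hc.isSol t ht)
    have h2 := (h1.clm_apply (hasDerivWithinAt_linearized_fst ha hY ht)).fun_sub
      ((hasDerivWithinAt_id t (Icc 0 1)).mul_const (vmom F (c 0) (Y 0).2))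
    refine h2.congr_deriv ?_
    rw [← he0, ← hconst t ht, fderiv_lag_apply, ← ha.eulerLagrange _ (hcs t ht)]
    simp [sprayField]
  have := constant_of_derivWithin_zero (fun t ht => (hq t ht).differentiableWithinAt)
    (fun t ht => (hq t (Ico_subset_Icc_self ht)).derivWithin
      (uniqueDiff_Icc t (Ico_subset_Icc_self ht))) 1 m1
  simp only [hY0, map_zero, zero_mul, one_mul, sub_zero] at this
  linarith

end

end FinslerBall

namespace FinslerBall

variable {n : ℕ}

/-! ### The inverse of the exponential map -/

/-- A bounded right inverse of a continuous function is continuous where the preimage is unique. -/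
theorem tendsto_of_leftInverse_of_isCompact {X Y : Type*} [TopologicalSpace X]
    [TopologicalSpace Y] [T2Space Y] {K T : Set X} (hK : IsCompact K) (hT : IsClosed T)
    {f : X → Y} (hf : Continuous f) {g : Y → X} {l : Filter Y} {y : Y} {x : X} (hl : l ≤ 𝓝 y)
    (hgK : ∀ᶠ z in l, g z ∈ K) (hgT : ∀ᶠ z in l, g z ∈ T) (hfg : ∀ᶠ z in l, f (g z) = z)
    (huniq : ∀ v ∈ T, f v = y → v = x) : Filter.Tendsto g l (𝓝 x) := by
  refine hK.tendsto_nhds_of_unique_mapClusterPt hgK fun v _ hv => huniq v ?_ ?_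
  · by_contra hcon
    obtain ⟨z, h1, h2⟩ := ((hv.frequently (hT.isOpen_compl.mem_nhds hcon)).and_eventually
      hgT).exists
    exact h1 h2
  · have h1 : Filter.Tendsto (f ∘ g) l (𝓝 y) :=
      (Filter.tendsto_id.mono_left hl).congr' (by filter_upwards [hfg] with z hz using hz.symm)
    have h2 : ClusterPt (f v) (𝓝 y) := ClusterPt.mono (hv.continuousAt_comp hf.continuousAt) h1
    exact eq_of_nhds_neBot h2

section

variable {F : Euc n → Euc n → ℝ} (hF : IsSimpleFinsler F) {a : Euc n × Euc n → Euc n}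
  (ha : IsGeodesicSpray F a)
include hF ha

omit hF ha in
theorem eventually_mem_ne {x y : Euc n} (hxy : x ≠ y) :
    ∀ᶠ y' in 𝓝[cBall n] y, y' ∈ cBall n ∧ x ≠ y' := by
  filter_upwards [self_mem_nhdsWithin, nhdsWithin_le_nhds (isOpen_ne.mem_nhds hxy.symm)]
    with y' h1 h2 using ⟨h1, h2.symm⟩

/-- A compactly supported field whose flow contains all geodesics of the ball. -/
theorem exists_geodesic_flow : ∃ (R : ℝ) (Φ : Euc n × Euc n → ℝ → Euc n × Euc n),
    (∀ v, Φ v 0 = v) ∧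
    (∀ c, IsOrbit a c → EqOn (Φ (c 0)) c (Icc 0 1) ∧ ∀ t ∈ Icc (0 : ℝ) 1, ‖c t‖ ≤ R) ∧
    (∀ v, (∀ t ∈ Icc (0 : ℝ) 1, (Φ v t).1 ∈ cBall n ∧ ‖Φ v t‖ ≤ R) → IsOrbit a (Φ v)) ∧
    (∀ t ∈ Icc (0 : ℝ) 1, Continuous fun v => Φ v t) ∧
    ∀ c, IsOrbit a c → ∃ D : Euc n × Euc n →L[ℝ] Euc n × Euc n,
      HasFDerivAt (fun w => Φ w 1) D (c 0) ∧ ∀ w, ∃ Y : ℝ → Euc n × Euc n,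
        Y 0 = w ∧ Y 1 = D w ∧ IsSol (fun t => fderiv ℝ (sprayField a) (c t)) Y := by
  obtain ⟨R, hR0, hR⟩ := exists_orbit_bound hF ha
  obtain ⟨X, hX, hXs, hXe⟩ := ha.exists_cutoff hR0
  obtain ⟨K, hK⟩ := hX.lipschitzWith_of_hasCompactSupport hXs one_ne_zero
  obtain ⟨Φ, hΦ0, hΦ, ⟨L, hL⟩, hΦD⟩ := exists_flow hX hXs
  have heq : ∀ c, IsOrbit a c → EqOn (Φ (c 0)) c (Icc 0 1) := by
    intro c hc
    refine IsSol.eqOn (s := univ) (f := fun _ => X) (fun t _ => hK.lipschitzOnWith) (hΦ _)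
      (fun t ht => ?_) (mapsTo_univ _ _) (mapsTo_univ _ _) (hΦ0 _)
    have := hc.isSol t ht
    simp only at this ⊢
    rwa [(hXe _ (hR c hc t ht)).1]
  refine ⟨R, Φ, hΦ0, fun c hc => ⟨heq c hc, hR c hc⟩, fun v hv => ⟨fun t ht => ?_,
    fun t ht => (hv t ht).1⟩, fun t ht => ?_, fun c hc => ?_⟩
  · have := hΦ v t ht
    simp only at this ⊢
    rwa [(hXe _ (hv t ht).2).1] at this
  · exact (LipschitzWith.of_dist_le_mul fun v w => hL v w t ht).continuous
  · obtain ⟨D, hD, hY⟩ := hΦD (c 0)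
    refine ⟨D, hD, fun w => ?_⟩
    obtain ⟨Y, hY0, hY1, hYs⟩ := hY w
    refine ⟨Y, hY0, hY1, fun t ht => ?_⟩
    have := hYs t ht
    simp only at this ⊢
    rwa [heq c hc ht, (hXe _ (hR c hc t ht)).2] at this

theorem velocity_ne_zero {c : ℝ → Euc n × Euc n} (hc : IsOrbit a c)
    (hne : (c 0).1 ≠ (c 1).1) {t : ℝ} (ht : t ∈ Icc (0 : ℝ) 1) : c t ∈ slit n := by
  refine hc.mem_slit hF.toIsReversibleFinsler ha (fun h0 => hne ?_) ht
  have h1 := ha.isSol_unique (d := fun _ => c 0) hc.isSol (fun t ht => ?_) rfl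
    (show (1 : ℝ) ∈ Icc (0 : ℝ) 1 by simp)
  · rw [h1]
  · have : sprayField a (c 0) = 0 := by
      have h2 : c 0 = ((c 0).1, 0) := by rw [← h0]
      rw [h2, sprayField, ha.apply_zero]; rfl
    simp only [this]
    exact hasDerivWithinAt_const _ _ _

/-- The initial velocities are bounded by `exists_orbit_bound`, and staying in the ball on `[0,1]`
is a closed condition. Any cluster point is thus the velocity of a geodesic in the ball from `x` to
`y`, which is unique. -/
theorem tendsto_expInv {x y : Euc n} (hx : x ∈ cBall n) (hxy : x ≠ y) :
    Filter.Tendsto (expInv F x) (𝓝[cBall n] y) (𝓝 (expInv F x y)) := by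
  have m0 : (0 : ℝ) ∈ Icc (0 : ℝ) 1 := by simp
  have m1 : (1 : ℝ) ∈ Icc (0 : ℝ) 1 := by simp
  obtain ⟨R, Φ, hΦ0, hΦc, hΦo, hΦcont, -⟩ := exists_geodesic_flow hF ha
  have hspec : ∀ y' ∈ cBall n, x ≠ y' → (Φ (x, expInv F x y') 1).1 = y' ∧
      ∀ t ∈ Icc (0 : ℝ) 1, (Φ (x, expInv F x y') t).1 ∈ cBall n ∧
        ‖Φ (x, expInv F x y') t‖ ≤ R := by
    intro y' hy' hxy'
    obtain ⟨d, hd, hd0, hd1⟩ := expInv_spec hF ha hx hy' hxy'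
    obtain ⟨h1, h2⟩ := hΦc d hd
    rw [hd0] at h1
    refine ⟨by rw [h1 m1, hd1], fun t ht => ?_⟩
    rw [h1 ht]
    exact ⟨hd.mapsTo ht, h2 t ht⟩
  have hΦx : ∀ t ∈ Icc (0 : ℝ) 1, Continuous fun v : Euc n => Φ (x, v) t :=
    fun t ht => (hΦcont t ht).comp (by fun_prop : Continuous fun v : Euc n => (x, v))
  have hev := eventually_mem_ne hxy
  refine tendsto_of_leftInverse_of_isCompact (isCompact_closedBall (0 : Euc n) R)
    (T := {v : Euc n | ∀ t ∈ Icc (0 : ℝ) 1, (Φ (x, v) t).1 ∈ cBall n ∧ ‖Φ (x, v) t‖ ≤ R})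
    (f := fun v => (Φ (x, v) 1).1) ?_ (continuous_fst.comp (hΦx 1 m1)) nhdsWithin_le_nhds
    ?_ ?_ ?_ ?_
  · have hT : {v : Euc n | ∀ t ∈ Icc (0 : ℝ) 1, (Φ (x, v) t).1 ∈ cBall n ∧ ‖Φ (x, v) t‖ ≤ R} =
        ⋂ t ∈ Icc (0 : ℝ) 1, {v | (Φ (x, v) t).1 ∈ cBall n ∧ ‖Φ (x, v) t‖ ≤ R} := by
      ext v; simp
    rw [hT]
    refine isClosed_biInter fun t ht => ?_
    have h1 : IsClosed ((fun v => (Φ (x, v) t).1) ⁻¹' cBall n) :=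
      isClosed_closedBall.preimage (hΦx t ht).fst
    have h2 : IsClosed {v | ‖Φ (x, v) t‖ ≤ R} := isClosed_le (hΦx t ht).norm continuous_const
    exact h1.inter h2
  · filter_upwards [hev] with y' hy'
    have := ((hspec y' hy'.1 hy'.2).2 0 m0).2
    rw [hΦ0] at this
    rw [mem_closedBall_zero_iff]
    exact (norm_snd_le _).trans this
  · filter_upwards [hev] with y' hy' using (hspec y' hy'.1 hy'.2).2
  · filter_upwards [hev] with y' hy' using (hspec y' hy'.1 hy'.2).1
  · intro v h1 h2
    have h4 := expInv_eq hF ha (hΦo _ h1) (by rw [hΦ0]; exact hxy.trans_eq h2.symm)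
    rw [hΦ0, h2] at h4
    exact h4.symm

/-- The absence of conjugate points makes the linearized exponential map injective. -/
theorem linearized_injective {c Y : ℝ → Euc n × Euc n} (hc : IsOrbit a c)
    (hne : (c 0).1 ≠ (c 1).1) (hY : IsSol (fun t => fderiv ℝ (sprayField a) (c t)) Y)
    (h0 : (Y 0).1 = 0) (h1 : (Y 1).1 = 0) : (Y 0).2 = 0 := by
  have hF' := hF.toIsReversibleFinsler
  have m0 : (0 : ℝ) ∈ Icc (0 : ℝ) 1 := by simp
  have hcs : ∀ t ∈ Icc (0 : ℝ) 1, c t ∈ slit n := fun t ht => velocity_ne_zero hF ha hc hne ht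
  have hJ0 := hF.noConjugate _ (hc.isGeodesic hF' ha) (fun t ht => by
    rw [hc.derivWithin_eq ht]; exact (hcs t ht).2) _ (isJacobiField_linearized hF' ha hc hcs hY)
    h0 h1
  have h2 : HasDerivWithinAt (fun t => (Y t).1) 0 (Icc 0 1) 0 :=
    (hasDerivWithinAt_const (0 : ℝ) _ (0 : Euc n)).congr hJ0 (hJ0 0 m0)
  exact (uniqueDiff_Icc 0 m0).eq_deriv _ (hasDerivWithinAt_linearized_fst ha hY m0) h2

/-- The flow defines the endpoint map near the velocity even where geodesics leave the ball, so its
derivative is two-sided. `expInv` is a continuous right inverse of it within the ball; the second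
conclusion is the Gauss lemma for the inverse derivative. -/
theorem hasFDerivWithinAt_expInv {c : ℝ → Euc n × Euc n} (hc : IsOrbit a c)
    (hne : (c 0).1 ≠ (c 1).1) : ∃ L : Euc n →L[ℝ] Euc n,
      HasFDerivWithinAt (expInv F (c 0).1) L (cBall n) (c 1).1 ∧
      ∀ w, vmom F (c 0) (L w) = vmom F (c 1) w := by
  have hF' := hF.toIsReversibleFinsler
  have m0 : (0 : ℝ) ∈ Icc (0 : ℝ) 1 := by simp
  have m1 : (1 : ℝ) ∈ Icc (0 : ℝ) 1 := by simp
  obtain ⟨R, Φ, -, hΦc, -, -, hΦD⟩ := exists_geodesic_flow hF ha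
  obtain ⟨D, hD, hDY⟩ := hΦD c hc
  obtain ⟨x, hx⟩ : ∃ x, x = (c 0).1 := ⟨_, rfl⟩
  obtain ⟨y, hy⟩ : ∃ y, y = (c 1).1 := ⟨_, rfl⟩
  have hEc := expInv_eq hF ha hc hne
  have hcs : ∀ t ∈ Icc (0 : ℝ) 1, c t ∈ slit n := fun t ht => velocity_ne_zero hF ha hc hne ht
  have hxB : x ∈ cBall n := hx ▸ hc.mapsTo m0
  have hyB : y ∈ cBall n := hy ▸ hc.mapsTo m1
  rw [← hx, ← hy] at hne hEc ⊢
  have hc0 : c 0 = (x, expInv F x y) := by rw [hEc, hx]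
  let D' : Euc n →L[ℝ] Euc n := (ContinuousLinearMap.fst ℝ (Euc n) (Euc n)).comp
    (D.comp (ContinuousLinearMap.inr ℝ (Euc n) (Euc n)))
  have hex : HasFDerivAt (fun v => (Φ (x, v) 1).1) D' (expInv F x y) := by
    have h1 : HasFDerivAt (fun w => Φ w 1) D (x, expInv F x y) := by rw [← hc0]; exact hD
    have h2 : HasFDerivAt (fun v => Φ (x, v) 1)
        (D.comp (ContinuousLinearMap.inr ℝ (Euc n) (Euc n))) (expInv F x y) :=
      HasFDerivAt.comp (expInv F x y) (g := fun w => Φ w 1) h1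
        (hasFDerivAt_prodMk_right (𝕜 := ℝ) x (expInv F x y))
    exact h2.fst
  have hinj : Function.Injective (D' : Euc n →ₗ[ℝ] Euc n) := by
    rw [injective_iff_map_eq_zero]
    intro w hw
    obtain ⟨Y, hY0, hY1, hY⟩ := hDY (0, w)
    have := linearized_injective hF ha hc (by rw [← hx, ← hy]; exact hne) hY (by rw [hY0])
      (by rw [hY1]; exact hw)
    rwa [hY0] at this
  let e : Euc n ≃L[ℝ] Euc n :=
    (LinearEquiv.ofInjectiveEndo (D' : Euc n →ₗ[ℝ] Euc n) hinj).toContinuousLinearEquiv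
  have he : (e : Euc n →L[ℝ] Euc n) = D' := by ext1 w; rfl
  refine ⟨e.symm, ?_, fun w => ?_⟩
  · refine HasFDerivWithinAt.of_local_left_inverse (f := fun v => (Φ (x, v) 1).1) (t := univ)
      (f' := e) ?_ ?_ hyB ?_
    · rw [nhdsWithin_univ]; exact tendsto_expInv hF ha hxB hne
    · rw [he]; exact hex.hasFDerivWithinAt
    · filter_upwards [eventually_mem_ne hne] with y' hy'
      obtain ⟨d, hd, hd0, hd1⟩ := expInv_spec hF ha hxB hy'.1 hy'.2
      rw [← hd0, (hΦc d hd).1 m1, hd1]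
  · obtain ⟨Y, hY0, hY1, hY⟩ := hDY (0, e.symm w)
    have h1 := gauss_lemma hF' ha hc hcs hY (by rw [hY0])
    have h2 : (D (0, e.symm w)).1 = w := by
      have h3 : D' (e.symm w) = w := by rw [← he]; exact e.apply_symm_apply w
      exact h3
    rw [hY0, hY1, h2] at h1
    exact h1.symm

end

/-! ### The length metric -/

theorem IsReversibleFinsler.hasFDerivAt_apply {F : Euc n → Euc n → ℝ} (hF : IsReversibleFinsler F)
    {x v : Euc n} (hp : (x, v) ∈ slit n) :
    HasFDerivAt (F x) ((F x v)⁻¹ • vmom F (x, v)) v := by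
  have hpos := hF.pos x hp.1 v hp.2
  have h1 : HasFDerivAt (fun w => lag F (x, w)) (vmom F (x, v)) v :=
    HasFDerivAt.comp v (g := lag F)
      ((hF.contDiffAt_lag hp).differentiableAt (by simp)).hasFDerivAt
      (hasFDerivAt_prodMk_right (𝕜 := ℝ) x v)
  have h2 : ∀ w, √(2 * lag F (x, w)) = F x w := by
    intro w
    rw [lag, mul_div_cancel₀ _ two_ne_zero]
    exact Real.sqrt_sq (hF.nonneg hp.1 w)
  have h3 := (h1.const_mul 2).sqrt (by simp only [lag]; positivity)
  simp only [h2] at h3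
  refine h3.congr_fderiv ?_
  rw [smul_smul]
  congr 1
  field_simp

section

variable {F : Euc n → Euc n → ℝ} (hF : IsSimpleFinsler F) {a : Euc n × Euc n → Euc n}
  (ha : IsGeodesicSpray F a)
include hF ha

/-- The first variation formula for the geodesic distance. -/
theorem hasFDerivWithinAt_radius {c : ℝ → Euc n × Euc n} (hc : IsOrbit a c)
    (hne : (c 0).1 ≠ (c 1).1) :
    HasFDerivWithinAt (fun y => F (c 0).1 (expInv F (c 0).1 y))
      ((F (c 0).1 (c 0).2)⁻¹ • vmom F (c 1)) (cBall n) (c 1).1 := by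
  obtain ⟨L, hL, hLw⟩ := hasFDerivWithinAt_expInv hF ha hc hne
  have hs := velocity_ne_zero hF ha hc hne (show (0 : ℝ) ∈ Icc (0 : ℝ) 1 by simp)
  have h1 := hF.toIsReversibleFinsler.hasFDerivAt_apply (x := (c 0).1) (v := (c 0).2) hs
  have h2 : HasFDerivAt (F (c 0).1) ((F (c 0).1 (c 0).2)⁻¹ • vmom F (c 0))
      (expInv F (c 0).1 (c 1).1) := by rw [expInv_eq hF ha hc hne]; exact h1
  have h3 := h2.comp_hasFDerivWithinAt _ hL
  refine h3.congr_fderiv ?_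
  ext1 w
  simp [hLw]

theorem expInv_reverse {c : ℝ → Euc n × Euc n} (hc : IsOrbit a c) (hne : (c 0).1 ≠ (c 1).1) :
    expInv F (c 1).1 (c 0).1 = -(c 1).2 := by
  have h := hc.reparam hF.toIsReversibleFinsler ha (r := 1) (s := 0) (by simp) (by simp)
    one_ne_zero
  have := expInv_eq hF ha h (by simpa using hne.symm)
  simpa using this

theorem radius_symm {x y : Euc n} (hx : x ∈ cBall n) (hy : y ∈ cBall n) (hxy : x ≠ y) :
    F y (expInv F y x) = F x (expInv F x y) := by
  obtain ⟨c, hc, hc0, rfl⟩ := expInv_spec hF ha hx hy hxy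
  have h0 : (c 0).1 = x := by rw [hc0]
  have h1 := expInv_reverse hF ha hc (by rw [h0]; exact hxy)
  rw [h0] at h1
  rw [h1, hF.apply_neg hy, hc.speed_eq hF.toIsReversibleFinsler ha (by simp), hc0]

theorem exists_radius_le : ∃ δ > 0, ∃ C : ℝ, ∀ x ∈ cBall n, ∀ y ∈ cBall n, x ≠ y →
    ‖y - x‖ ≤ δ → F x (expInv F x y) ≤ C * ‖y - x‖ := by
  obtain ⟨m, M, hm, hM, hb⟩ := hF.exists_norm_bounds
  obtain ⟨δ, hδ, h⟩ := exists_short_geodesic hF ha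
  refine ⟨δ, hδ, M * 2, fun x hx y hy hxy hle => ?_⟩
  obtain ⟨c, hc, rfl, rfl, hv⟩ := h x hx y hy hle
  rw [expInv_eq hF ha hc hxy, mul_assoc]
  exact (hb _ hx _).2.trans (by gcongr)

/-- Curves are at least as long as geodesics. -/
theorem radius_le_length {x y : Euc n} (hx : x ∈ cBall n) (hxy : x ≠ y)
    {c : ℝ → Euc n} (hc : ContDiffOn ℝ ∞ c (Icc 0 1)) (hcB : MapsTo c (Icc 0 1) (cBall n))
    (h0 : c 0 = x) (h1 : c 1 = y) :
    F x (expInv F x y) ≤ ∫ t in (0 : ℝ)..1, F (c t) (derivWithin c (Icc 0 1) t) := by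
  have hF' := hF.toIsReversibleFinsler
  set σ := derivWithin c (Icc 0 1)
  set φ : ℝ → ℝ := fun t => F (c t) (σ t) with hφ
  have hσ : ContinuousOn σ (Icc 0 1) := hc.continuousOn_derivWithin uniqueDiff_Icc (by simp)
  have hφc : ContinuousOn φ (Icc 0 1) :=
    hF'.continuousOn.comp (hc.continuousOn.prodMk hσ) (fun t ht => ⟨hcB ht, trivial⟩)
  have hφ0 : ∀ t ∈ Icc (0 : ℝ) 1, 0 ≤ φ t := fun t ht => hF'.nonneg (hcB ht) _
  obtain ⟨δ, hδ, C, hC⟩ := exists_radius_le hF ha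
  -- the last time at which the curve is at `x`
  have hcomp : IsCompact (Icc 0 1 ∩ c ⁻¹' {x}) := isCompact_Icc.of_isClosed_subset
    (hc.continuousOn.preimage_isClosed_of_isClosed isClosed_Icc isClosed_singleton)
    inter_subset_left
  obtain ⟨t₀, ⟨ht₀, hct₀⟩, hlast⟩ := hcomp.exists_isGreatest ⟨0, by simp, h0⟩
  have hct₀' : c t₀ = x := hct₀
  have ht₀1 : t₀ < 1 := lt_of_le_of_ne ht₀.2 (by rintro rfl; exact hxy (hct₀'.symm.trans h1))
  have hafter : ∀ t ∈ Ioc t₀ 1, x ≠ c t := fun t ht h =>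
    absurd (hlast ⟨⟨ht₀.1.trans ht.1.le, ht.2⟩, h.symm⟩) (not_le.2 ht.1)
  set ρ : ℝ → ℝ := fun t => F x (expInv F x (c t)) with hρ
  -- First variation expresses the derivative of the radius by the momentum of the connecting
  -- geodesic at its endpoint, and the fundamental inequality bounds it by the speed of the curve.
  have hρd : ∀ t ∈ Ioc t₀ 1, ∃ d ≤ φ t, HasDerivWithinAt ρ d (Icc 0 1) t := by
    intro t ht
    have htI : t ∈ Icc (0 : ℝ) 1 := ⟨ht₀.1.trans ht.1.le, ht.2⟩
    obtain ⟨b, hb, hb0, hb1⟩ := expInv_spec hF ha hx (hcB htI) (hafter t ht)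
    have hbx : (b 0).1 = x := by rw [hb0]
    have hne : (b 0).1 ≠ (b 1).1 := by rw [hbx, hb1]; exact hafter t ht
    have h2 := hasFDerivWithinAt_radius hF ha hb hne
    have h3 : HasDerivWithinAt c (σ t) (Icc 0 1) t :=
      (hc.differentiableOn (by simp) t htI).hasDerivWithinAt
    rw [hbx, hb1] at h2
    refine ⟨_, ?_, h2.comp_hasDerivWithinAt t h3 hcB⟩
    have hs := velocity_ne_zero hF ha hb hne (show (1 : ℝ) ∈ Icc (0 : ℝ) 1 by simp)
    have hpos := hF'.pos _ hs.1 _ hs.2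
    have h4 := hF'.vmom_le hs (σ t)
    have h5 := hb.speed_eq hF' ha (show (1 : ℝ) ∈ Icc (0 : ℝ) 1 by simp)
    rw [hbx] at h5
    rw [← h5, smul_apply, smul_eq_mul, inv_mul_le_iff₀ hpos]
    rwa [hb1] at h4 ⊢
  have hmain : ∀ t ∈ Ioo t₀ 1, ρ 1 ≤ (∫ t in (0 : ℝ)..1, φ t) + ρ t := by
    intro t ht
    have ht0 : 0 ≤ t := ht₀.1.trans ht.1.le
    have hsub : Icc t 1 ⊆ Icc 0 1 := Icc_subset_Icc_left ht0
    have hsub2 : Icc t 1 ⊆ Ioc t₀ 1 := fun s hs => ⟨ht.1.trans_le hs.1, hs.2⟩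
    choose! d hdle hd using hρd
    have h2 := intervalIntegral.sub_le_integral_of_hasDeriv_right_of_le (g := ρ) (g' := d)
      (φ := φ) ht.2.le (fun s hs => ((hd s (hsub2 hs)).continuousWithinAt.mono hsub))
      (fun s hs => ((hd s (hsub2 (Ioo_subset_Icc_self hs))).hasDerivAt
        (Icc_mem_nhds (ht0.trans_lt hs.1) hs.2)).hasDerivWithinAt)
      ((hφc.mono hsub).integrableOn_Icc) (fun s hs => hdle s (hsub2 (Ioo_subset_Icc_self hs)))
    have i1 : IntervalIntegrable φ MeasureTheory.volume 0 t :=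
      (hφc.mono (Icc_subset_Icc_right ht.2.le)).intervalIntegrable_of_Icc ht0
    have i2 : IntervalIntegrable φ MeasureTheory.volume t 1 :=
      (hφc.mono hsub).intervalIntegrable_of_Icc ht.2.le
    have h3 := intervalIntegral.integral_add_adjacent_intervals i1 i2
    have h4 : 0 ≤ ∫ s in (0 : ℝ)..t, φ s :=
      intervalIntegral.integral_nonneg ht0 fun s hs => hφ0 s ⟨hs.1, hs.2.trans ht.2.le⟩
    linarith
  have hρ1 : ρ 1 = F x (expInv F x y) := by rw [hρ, ← h1]
  rw [← hρ1]
  have hIcc : Icc (0 : ℝ) 1 ∈ 𝓝[>] t₀ := by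
    filter_upwards [Ioo_mem_nhdsGT ht₀1] with t ht using ⟨ht₀.1.trans ht.1.le, ht.2.le⟩
  have hlim : Filter.Tendsto c (𝓝[>] t₀) (𝓝 x) := by
    rw [← hct₀']
    exact (hc.continuousOn t₀ ht₀).mono_left (nhdsWithin_le_of_mem hIcc)
  -- The first variation requires `c t ≠ x`, so the comparison starts just after `t₀`; the initial
  -- radius is `O(‖c t - x‖)` and disappears in the limit.
  have hlim2 : Filter.Tendsto (fun t => (∫ t in (0 : ℝ)..1, φ t) + C * ‖c t - x‖) (𝓝[>] t₀)
      (𝓝 (∫ t in (0 : ℝ)..1, φ t)) := by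
    have := ((hlim.sub_const x).norm.const_mul C).const_add (∫ t in (0 : ℝ)..1, φ t)
    simpa using this
  refine ge_of_tendsto hlim2 ?_
  have hclose : ∀ᶠ t in 𝓝[>] t₀, ‖c t - x‖ ≤ δ := by
    have := hlim.eventually (closedBall_mem_nhds x hδ)
    filter_upwards [this] with t ht
    rwa [dist_eq_norm] at ht
  filter_upwards [hclose, Ioo_mem_nhdsGT ht₀1] with t ht1 ht2
  have h2 := hC x hx (c t) (hcB ⟨ht₀.1.trans ht2.1.le, ht2.2.le⟩)
    (hafter t (Ioo_subset_Ioc_self ht2)) ht1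
  exact (hmain t ht2).trans (by gcongr)

theorem IsOrbit.contDiffOn_top {c : ℝ → Euc n × Euc n} (hc : IsOrbit a c)
    (hne : (c 0).1 ≠ (c 1).1) : ContDiffOn ℝ ∞ c (Icc 0 1) := by
  refine ODE.contDiffOn_enat_Icc_of_hasDerivWithinAt (n := ⊤) (f := fun _ => sprayField a)
    (u := {p | p.2 ≠ 0}) ?_ hc.isSol (fun t ht => (velocity_ne_zero hF ha hc hne ht).2)
  intro q hq
  have h1 : ContDiffAt ℝ ∞ (sprayField a) q.2 := contDiffAt_snd.prodMk (ha.contDiffAt _ hq.2)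
  exact (h1.comp q contDiffAt_snd).contDiffWithinAt

/-- The length metric is the length of the connecting geodesic. -/
theorem lengthDist_eq {x y : Euc n} (hx : x ∈ cBall n) (hy : y ∈ cBall n) (hxy : x ≠ y) :
    lengthDist F x y = F x (expInv F x y) := by
  have hF' := hF.toIsReversibleFinsler
  obtain ⟨c, hc, hc0, hc1⟩ := expInv_spec hF ha hx hy hxy
  have hne : (c 0).1 ≠ (c 1).1 := by rw [hc0, hc1]; exact hxy
  have hmem : F x (expInv F x y) ∈ {L : ℝ | ∃ c : ℝ → Euc n, ContDiffOn ℝ ∞ c (Icc 0 1) ∧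
      MapsTo c (Icc 0 1) (cBall n) ∧ c 0 = x ∧ c 1 = y ∧
      L = ∫ t in (0 : ℝ)..1, F (c t) (derivWithin c (Icc 0 1) t)} := by
    refine ⟨fun t => (c t).1, contDiff_fst.comp_contDiffOn (hc.contDiffOn_top hF ha hne),
      hc.mapsTo, by simp [hc0], hc1, ?_⟩
    have h1 : ∫ t in (0 : ℝ)..1, F (c t).1 (derivWithin (fun t => (c t).1) (Icc 0 1) t) =
        ∫ _ in (0 : ℝ)..1, F x (expInv F x y) := by
      refine intervalIntegral.integral_congr fun t ht => ?_
      rw [uIcc_of_le zero_le_one] at ht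
      rw [hc.derivWithin_eq ht, hc.speed_eq hF' ha ht, hc0]
    rw [h1]; simp
  have hlow : ∀ L ∈ {L : ℝ | ∃ c : ℝ → Euc n, ContDiffOn ℝ ∞ c (Icc 0 1) ∧
      MapsTo c (Icc 0 1) (cBall n) ∧ c 0 = x ∧ c 1 = y ∧
      L = ∫ t in (0 : ℝ)..1, F (c t) (derivWithin c (Icc 0 1) t)}, F x (expInv F x y) ≤ L := by
    rintro L ⟨b, hb, hbB, hb0, hb1, rfl⟩
    exact radius_le_length hF ha hx hxy hb hbB hb0 hb1
  exact le_antisymm (csInf_le ⟨_, hlow⟩ hmem) (le_csInf ⟨_, hmem⟩ hlow)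

theorem expInv_mem_slit {x y : Euc n} (hx : x ∈ cBall n) (hy : y ∈ cBall n) (hxy : x ≠ y) :
    (x, expInv F x y) ∈ slit n := by
  obtain ⟨c, hc, hc0, hc1⟩ := expInv_spec hF ha hx hy hxy
  rw [← hc0]
  exact velocity_ne_zero hF ha hc (by rw [hc0, hc1]; exact hxy) (by simp)

/-- Only the endpoint derivative of the radius is available, so the geodesic is taken from `y` to
`x` and the symmetry of the radius is used. Reversal negates the momentum at `x`, which gives the
sign. -/
theorem hasFDerivWithinAt_lengthDist {x y : Euc n} (hx : x ∈ cBall n) (hy : y ∈ cBall n)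
    (hxy : x ≠ y) : HasFDerivWithinAt (fun x' => lengthDist F x' y)
      (-((F x (expInv F x y))⁻¹ • vmom F (x, expInv F x y))) (cBall n) x := by
  obtain ⟨c, hc, hc0, rfl⟩ := expInv_spec hF ha hy hx hxy.symm
  have h0 : (c 0).1 = y := by rw [hc0]
  have hne : (c 0).1 ≠ (c 1).1 := by rw [h0]; exact hxy.symm
  have h1 := hasFDerivWithinAt_radius hF ha hc hne
  have h2 : expInv F (c 1).1 y = -(c 1).2 := by rw [← h0]; exact expInv_reverse hF ha hc hne
  have hs := velocity_ne_zero hF ha hc hne (show (1 : ℝ) ∈ Icc (0 : ℝ) 1 by simp)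
  have h3 : vmom F ((c 1).1, expInv F (c 1).1 y) = -vmom F (c 1) := by
    rw [h2, ← neg_one_smul ℝ (c 1).2, hF.vmom_smul (z := (c 1).1) (v := (c 1).2) hs (by norm_num)]
    exact neg_one_smul ℝ (vmom F (c 1))
  have h4 : F (c 1).1 (expInv F (c 1).1 y) = F (c 0).1 (c 0).2 := by
    rw [h2, hF.apply_neg hx, hc.speed_eq hF.toIsReversibleFinsler ha (by simp)]
  rw [h3, h4, smul_neg, neg_neg]
  have hcongr : ∀ x' ∈ cBall n, y ≠ x' →
      lengthDist F x' y = F (c 0).1 (expInv F (c 0).1 x') := by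
    intro x' hx' hne'
    rw [lengthDist_eq hF ha hx' hy hne'.symm, h0, radius_symm hF ha hy hx' hne']
  refine h1.congr_of_eventuallyEq ?_ (hcongr _ hx hxy.symm)
  filter_upwards [eventually_mem_ne hxy.symm] with x' hx' using hcongr x' hx'.1 hx'.2

theorem d₁_eq {x y : Euc n} (hx : x ∈ cBall n) (hy : y ∈ cBall n) (hxy : x ≠ y) :
    d₁ F x y = -((F x (expInv F x y))⁻¹ • vmom F (x, expInv F x y)) :=
  (hasFDerivWithinAt_lengthDist hF ha hx hy hxy).fderivWithin (uniqueDiffOn_cBall x hx)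

end

/-! ### The mixed second derivative -/

/-- The derivative of `v ↦ ∂F/∂v`. -/
theorem IsReversibleFinsler.hasFDerivAt_unit_vmom {F : Euc n → Euc n → ℝ}
    (hF : IsReversibleFinsler F) {x v : Euc n} (hp : (x, v) ∈ slit n) :
    ∃ G : Euc n →L[ℝ] Euc n →L[ℝ] ℝ,
      HasFDerivAt (fun v => -((F x v)⁻¹ • vmom F (x, v))) G v ∧
      ∀ ξ u, G ξ u = -((F x v)⁻¹ * fderiv ℝ (vmom F) (x, v) (0, ξ) u -
        (F x v)⁻¹ ^ 3 * vmom F (x, v) ξ * vmom F (x, v) u) := by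
  have hpos := hF.pos x hp.1 v hp.2
  have h1 : HasFDerivAt (fun w => vmom F (x, w)) _ v :=
    HasFDerivAt.comp v (g := vmom F) (hasFDerivAt_vmom (hF.contDiffAt_lag hp))
      (hasFDerivAt_prodMk_right (𝕜 := ℝ) x v)
  have h2 := (hasDerivAt_inv hpos.ne').comp_hasFDerivAt v (hF.hasFDerivAt_apply hp)
  refine ⟨_, (HasFDerivAt.smul h2 h1).neg, fun ξ u => ?_⟩
  simp
  field_simp
  ring

theorem mixed_derivative (n : ℕ) (F : Euc n → Euc n → ℝ) (hF : FinslerBall.IsSimpleFinsler F)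
    (x y : Euc n) (hx : x ∈ cBall n) (hy : y ∈ cBall n) (hxy : x ≠ y) :
    0 < FinslerBall.lengthDist F x y ∧
    F x (FinslerBall.dirVec F x y) = 1 ∧
    DifferentiableWithinAt ℝ (FinslerBall.expInv F x) (cBall n) y ∧
    (∀ y' ∈ cBall n, y' ≠ x →
      DifferentiableWithinAt ℝ (fun x' => FinslerBall.lengthDist F x' y') (cBall n) x) ∧
    DifferentiableWithinAt ℝ (fun y' => FinslerBall.d₁ F x y') (cBall n) y ∧
    ∀ v w : Euc n,
      FinslerBall.D₁₂ F x y v w =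
        -FinslerBall.fundTensor F x (FinslerBall.dirVec F x y)
            (FinslerBall.proj F x (FinslerBall.dirVec F x y) v)
            (fderivWithin ℝ (FinslerBall.expInv F x) (cBall n) y w)
          / FinslerBall.lengthDist F x y := by
  have hF' := hF.toIsReversibleFinsler
  obtain ⟨a, hspray, hEL⟩ := hF'.exists_spray
  have ha : IsGeodesicSpray F a := ⟨hspray, hEL⟩
  have hp := expInv_mem_slit hF ha hx hy hxy
  have hpos : 0 < F x (expInv F x y) := hF'.pos x hx _ hp.2
  have hℓ := lengthDist_eq hF ha hx hy hxy
  obtain ⟨L, hL⟩ : ∃ L : Euc n →L[ℝ] Euc n, HasFDerivWithinAt (expInv F x) L (cBall n) y := by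
    obtain ⟨c, hc, hc0, hc1⟩ := expInv_spec hF ha hx hy hxy
    obtain ⟨L, hL, -⟩ := hasFDerivWithinAt_expInv hF ha hc (by rw [hc0, hc1]; exact hxy)
    rw [hc0, hc1] at hL
    exact ⟨L, hL⟩
  obtain ⟨G, hG, hGv⟩ := hF'.hasFDerivAt_unit_vmom hp
  -- Near `y` the covector `d₁ F x y'` is a fixed function of `expInv F x y'`, so the chain rule
  -- suffices.
  have hd : HasFDerivWithinAt (fun y' => d₁ F x y') (G.comp L) (cBall n) y := by
    refine (hG.comp_hasFDerivWithinAt y hL).congr_of_eventuallyEq ?_ (d₁_eq hF ha hx hy hxy)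
    filter_upwards [eventually_mem_ne hxy] with y' hy' using d₁_eq hF ha hx hy'.1 hy'.2
  refine ⟨hℓ ▸ hpos, ?_, hL.differentiableWithinAt, fun y' hy' hne =>
    (hasFDerivWithinAt_lengthDist hF ha hx hy' hne.symm).differentiableWithinAt,
    hd.differentiableWithinAt, fun v w => ?_⟩
  · rw [dirVec, hF'.homog x hx, hℓ, abs_of_pos (inv_pos.2 hpos), inv_mul_cancel₀ hpos.ne']
  · have hu := uniqueDiffOn_cBall y hy
    rw [D₁₂, hd.fderivWithin hu, hL.fderivWithin hu, dirVec, hℓ]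
    set e := expInv F x y
    set r := F x e
    have hr : r⁻¹ ≠ 0 := inv_ne_zero hpos.ne'
    have hps := IsReversibleFinsler.smul_mem_slit hp hr
    -- The fundamental tensor is homogeneous of degree zero in its reference vector, so `g_u` may be
    -- computed at `e`.
    have htensor : ∀ u₁ u₂, fundTensor F x (r⁻¹ • e) u₁ u₂ =
        fderiv ℝ (vmom F) (x, e) (0, u₁) u₂ := by
      intro u₁ u₂
      rw [hF'.fundTensor_eq hps]
      have h1 := hF'.fderiv_vmom_smul hp hr (0, u₁)
      have h2 : ((0 : Euc n), r⁻¹ • u₁) = r⁻¹ • ((0 : Euc n), u₁) := by simp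
      simp only at h1
      rw [h2, map_smul] at h1
      rw [smul_right_injective _ hr h1]
    -- By Euler's identity, pairing with `u = e / r` is `r⁻¹` times the momentum. The product of
    -- momenta in the Hessian of `F` is thereby the term that `P_u` subtracts.
    have hdir : ∀ u, fderiv ℝ (vmom F) (x, e) (0, r⁻¹ • e) u = r⁻¹ * vmom F (x, e) u := by
      intro u
      have h2 : ((0 : Euc n), r⁻¹ • e) = r⁻¹ • ((0 : Euc n), e) := by simp
      rw [h2, map_smul, smul_apply, hF'.fderiv_vmom_inr_self hp, smul_eq_mul]
    have hproj : ∀ s : ℝ, ((0 : Euc n), v - s • r⁻¹ • e) =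
        ((0 : Euc n), v) - s • ((0 : Euc n), r⁻¹ • e) := by intro s; simp
    rw [htensor, proj, htensor, hproj, map_sub, map_smul, sub_apply, smul_apply, hdir, hdir,
      ContinuousLinearMap.comp_apply, hGv, fderiv_vmom_apply_inr_comm (hF'.contDiffAt_lag hp) (L w)]
    simp only [smul_eq_mul]
    field_simp

end FinslerBall

theorem mainTheorem8 (n : ℕ) (F : Euc n → Euc n → ℝ) (hF : FinslerBall.IsSimpleFinsler F)
    (x y : Euc n) (hx : x ∈ cBall n) (hy : y ∈ cBall n) (hxy : x ≠ y) :
    0 < FinslerBall.lengthDist F x y ∧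
    F x (FinslerBall.dirVec F x y) = 1 ∧
    DifferentiableWithinAt ℝ (FinslerBall.expInv F x) (cBall n) y ∧
    (∀ y' ∈ cBall n, y' ≠ x →
      DifferentiableWithinAt ℝ (fun x' => FinslerBall.lengthDist F x' y') (cBall n) x) ∧
    DifferentiableWithinAt ℝ (fun y' => FinslerBall.d₁ F x y') (cBall n) y ∧
    ∀ v w : Euc n,
      FinslerBall.D₁₂ F x y v w =
        -FinslerBall.fundTensor F x (FinslerBall.dirVec F x y)
            (FinslerBall.proj F x (FinslerBall.dirVec F x y) v)
            (fderivWithin ℝ (FinslerBall.expInv F x) (cBall n) y w)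
          / FinslerBall.lengthDist F x y :=
  FinslerBall.mixed_derivative n F hF x y hx hy hxy
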